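/- Let $N\ge 1$, let $\Gamma_N=(\gamma_N^2(i,j))_{1\le i,j\le N}$ be a real symmetric matrix with nonnegative entries, put $\gamma_N(i,j)=\sqrt{\gamma_N^2(i,j)}$ and $\gamma_{\max}=\max_{i,j}\gamma_N(i,j)$, and let $Y_N\in \mathrm M_N(\mathbb C)$ be a deterministic Hermitian matrix. Let $(x_{i,j})_{1\le i,j\le N}$ be a random Hermitian matrix whose entries with $i\ge j$ are independent, with $x_{i,i}$ real standard Gaussian and, for $i\neq j$, $x_{i,j}$ centered complex Gaussian of variance one (independent real and imaginary parts, each $\mathcal N(0,\tfrac12)$). Put $$X_N=\Big(\gamma_N(i,j)\tfrac{x_{i,j}}{\sqrt N}\Big)_{i,j},\qquad H_N=X_N+Y_N,\qquad g_{H_N}(\lambda)=\tfrac1N\mathrm{Tr}\big[(\lambda\mathbb I_N-H_N)^{-1}\big].$$ Let $\mathrm D_N(\mathbb C)^{\pm}$ be the set of diagonal $N\times N$ matrices whose diagonal entries all have positive (resp. negative) imaginary part, let $\Delta(A)$ denote the diagonal part of a matrix $A$, and for diagonal $D$ let $\mathcal R_N(D)=\mathrm{diag}_{i}\big(\sum_{j}\tfrac{\gamma_N^2(i,j)}{N}D(j,j)\big)$.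 There is a unique map $G^\square:\mathrm D_N(\mathbb C)^+\to\mathrm D_N(\mathbb C)^-$, analytic in each variable, such that $$G^\square(\Lambda)=\Delta\Big[\big(\Lambda-\mathcal R_N(G^\square(\Lambda))-Y_N\big)^{-1}\Big]\qquad\text{for all }\Lambda\in\mathrm D_N(\mathbb C)^+;$$ moreover, for every $\lambda$ with $\Im\lambda>0$, $G^\square(\lambda\mathbb I_N)$ is the unique solution $D\in\mathrm D_N(\mathbb C)^-$ of $D=\Delta[(\lambda\mathbb I_N-\mathcal R_N(D)-Y_N)^{-1}]$. Put $g^\square_{H_N}(\lambda)=\tfrac1N\mathrm{Tr}\,G^\square(\lambda\mathbb I_N)$. Assume $\gamma_{\max}>0$, let $0<\delta<1$, and let $d>0$ be such that $N=1$ or $N^{-d}\le\tfrac12$ (this holds for all $N\geq 1$ if $d>1$). Let $\lambda\in\mathbb C$ with $\Im\lambda>0$. 1. If $\Im\lambda\ge\gamma_{\max}\big(\tfrac{2}{N(1-\delta)}\big)^{1/5}$, then $$\mathbb P\big(|g_{H_N}(\lambda)-g^\square_{H_N}(\lambda)|\ge\tilde\varepsilon_N(d)\big)\le N^{-d},$$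 where $$\tilde\varepsilon_N(d)=\frac{\sqrt2\,\gamma_{\max}\sqrt{2d\log N}}{|\Im\lambda|^2N}+\Big(1+\frac{\gamma_{\max}^2}{\delta|\Im\lambda|^2}\Big)\frac{2\gamma_{\max}^3}{N(\Im\lambda)^4}.$$ 2. If moreover $Y_N$ is diagonal and $\Im\lambda\ge\gamma_{\max}N^{-1/4}(1-\delta)^{-1/6}$ (in place of the condition in 1), then the same probability bound holds with the error $$\tilde\varepsilon_N(d)=\frac{\sqrt2\,\gamma_{\max}\sqrt{2d\log N}}{|\Im\lambda|^2}N^{-1}+\Big(1+\frac{\gamma_{\max}^2}{\delta|\Im\lambda|^2}\Big)\frac{\gamma_{\max}^4}{N^{3/2}(\Im\lambda)^5}.$$ -/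

import Mathlib

open MeasureTheory ProbabilityTheory

namespace VarianceProfile

/-- The law of a centered complex Gaussian variable of variance one: the real and imaginary parts
are independent centered real Gaussian variables of variance `1/2`. -/
noncomputable def stdComplexGaussian : Measure ℂ :=
  ((gaussianReal 0 (1 / 2)).prod (gaussianReal 0 (1 / 2))).map
    (fun p : ℝ × ℝ => (p.1 : ℂ) + (p.2 : ℂ) * Complex.I)

/-- `x` is a random Hermitian matrix such that `x / √N` is a GUE matrix of size `N`: the entries on
and below the diagonal are independent, the diagonal entries are real Gaussian with mean zero and
variance one, and the off-diagonal entries are complex Gaussian with mean zero and variance one. -/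
structure IsUnnormalizedGUE {Ω : Type*} [MeasurableSpace Ω] {N : ℕ}
    (x : Ω → Matrix (Fin N) (Fin N) ℂ) (P : Measure Ω) : Prop where
  isHermitian : ∀ ω, (x ω).IsHermitian
  indep : iIndepFun
    (fun (p : {p : Fin N × Fin N // p.2 ≤ p.1}) (ω : Ω) => x ω p.1.1 p.1.2) P
  diag_law : ∀ i, HasLaw (fun ω => (x ω i i).re) (gaussianReal 0 1) P
  offDiag_law : ∀ i j, j < i → HasLaw (fun ω => x ω i j) stdComplexGaussian P

/-- The matrix with entries `γ(i,j) x(i,j) / √N`, where `γ(i,j)² = Γ(i,j)`. -/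
noncomputable def withProfile {N : ℕ} (Γ : Matrix (Fin N) (Fin N) ℝ)
    (x : Matrix (Fin N) (Fin N) ℂ) : Matrix (Fin N) (Fin N) ℂ :=
  Matrix.of fun i j => ((√(Γ i j) : ℝ) : ℂ) * (x i j / ((√(N : ℝ) : ℝ) : ℂ))

/-- `γ_max`, the square root of the largest entry of the variance profile `Γ`. -/
noncomputable def gammaMax {N : ℕ} (Γ : Matrix (Fin N) (Fin N) ℝ) : ℝ :=
  √(⨆ p : Fin N × Fin N, Γ p.1 p.2)

/-- The Stieltjes transform `(1/N) Tr (λ - H)⁻¹` of the empirical spectral distribution of `H`. -/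
noncomputable def stieltjes {N : ℕ} (H : Matrix (Fin N) (Fin N) ℂ) (z : ℂ) : ℂ :=
  (1 / (N : ℂ)) * Matrix.trace ((Matrix.scalar (Fin N) z - H)⁻¹)

/-- Diagonal matrices whose diagonal entries have positive imaginary part. Throughout, a diagonal
matrix is represented by the vector of its diagonal entries. -/
def upperDiag (N : ℕ) : Set (Fin N → ℂ) := {D | ∀ i, 0 < (D i).im}

/-- Diagonal matrices whose diagonal entries have negative imaginary part. -/
def lowerDiag (N : ℕ) : Set (Fin N → ℂ) := {D | ∀ i, (D i).im < 0}

/-- The map `R_N`, sending `D` to the diagonal matrix with entries `∑ⱼ Γ(i,j) D(j,j) / N`. -/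
noncomputable def covMap {N : ℕ} (Γ : Matrix (Fin N) (Fin N) ℝ) (D : Fin N → ℂ) : Fin N → ℂ :=
  fun i => ∑ j, ((Γ i j : ℝ) : ℂ) / (N : ℂ) * D j

/-- The map `D ↦ Δ[(L - R_N(D) - Y)⁻¹]` on diagonal matrices, where `Δ` takes the diagonal. -/
noncomputable def fixMap {N : ℕ} (Γ : Matrix (Fin N) (Fin N) ℝ) (Y : Matrix (Fin N) (Fin N) ℂ)
    (L D : Fin N → ℂ) : Fin N → ℂ :=
  Matrix.diag ((Matrix.diagonal L - Matrix.diagonal (covMap Γ D) - Y)⁻¹)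

/-- `G` maps diagonal matrices with positive imaginary part to diagonal matrices with negative
imaginary part, is analytic in each variable there, and solves the fixed point equation
`G(L) = Δ[(L - R_N(G(L)) - Y)⁻¹]`. Values of `G` outside `upperDiag N` are irrelevant. -/
structure IsDetEquiv {N : ℕ} (Γ : Matrix (Fin N) (Fin N) ℝ) (Y : Matrix (Fin N) (Fin N) ℂ)
    (G : (Fin N → ℂ) → (Fin N → ℂ)) : Prop where
  mapsTo : Set.MapsTo G (upperDiag N) (lowerDiag N)
  analytic : ∀ L ∈ upperDiag N, ∀ i k : Fin N,
    AnalyticAt ℂ (fun z : ℂ => G (Function.update L i z) k) (L i)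
  fixedPoint : ∀ L ∈ upperDiag N, G L = fixMap Γ Y L (G L)

/-- `(1/N) Tr G(λ I_N)` for a map `G` on diagonal matrices. -/
noncomputable def scalarTrace {N : ℕ} (G : (Fin N → ℂ) → (Fin N → ℂ)) (z : ℂ) : ℂ :=
  (1 / (N : ℂ)) * Matrix.trace (Matrix.diagonal (G fun _ => z))

/-- The error `ε̃_N(d)` for general `Y`, with `g = γ_max` and `η = Im λ`. -/
noncomputable def errGeneral (N : ℕ) (g δ η d : ℝ) : ℝ :=
  √2 * g * √(2 * d * Real.log N) / (|η| ^ 2 * N)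
    + (1 + g ^ 2 / (δ * |η| ^ 2)) * (2 * g ^ 3 / (N * η ^ 4))

/-- The improved error `ε̃_N(d)` for diagonal `Y`, with `g = γ_max` and `η = Im λ`. -/
noncomputable def errDiagonal (N : ℕ) (g δ η d : ℝ) : ℝ :=
  √2 * g * √(2 * d * Real.log N) / |η| ^ 2 * (N : ℝ)⁻¹
    + (1 + g ^ 2 / (δ * |η| ^ 2)) * (g ^ 4 / ((N : ℝ) ^ (3 / 2 : ℝ) * η ^ 5))

end VarianceProfile

/-!
The fixed point equation is solved by iteration. For a Hermitian `K` and a diagonal `z` with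
positive imaginary part `m`, the resolvent `R = (z - K)⁻¹` satisfies the Ward identities
`-Im R_ii = ∑ⱼ mⱼ |R_ij|² = ∑ⱼ mⱼ |R_ji|²`. Together with the resolvent identity and the Cauchy-Schwarz
inequality they show that `D ↦ Δ[(L - R_N(D) - Y)⁻¹]` strictly contracts the weighted distance
`maxₖ |Dₖ - D'ₖ| / √(Im Dₖ Im D'ₖ)` (`norm_fixMap_sub_le`). This one estimate gives uniqueness of the
fixed point for every `L`, a Lipschitz bound in `L` (`norm_sub_le_of_fixedPoints`), and locally uniform
convergence of the iteration, hence existence and analyticity (`exists_isDetEquiv`).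

The random matrix is written as `∑ₖ gₖ Aₖ` with independent real standard Gaussian `gₖ`. Interpolating
along rotations of two independent Gaussian vectors gives a covariance inequality
(`norm_covariance_le`), which contains the Poincaré inequality and a bound on `E exp(a |W|²)` for a
centered complex function `W` whose squared gradient is bounded by `V`. Since the gradients of the real
and imaginary part are controlled jointly, one gets `P(|W|² ≥ 4 V L) ≤ exp(-L)` for `L ≥ log 2`
(`measure_norm_sq_ge_le`). For the Stieltjes transform `V = γ_max² / (N² η⁴)`, and `L = d log N` yields
the first term of the error.

For the bias, Gaussian integration by parts gives the Dyson equation (`dyson_equation`): the diagonal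
`E` of the expected resolvent solves the fixed point equation up to an error `Θ`, which is a covariance
of resolvent entries and is small by the Poincaré inequality (`norm_meanResolvent_sub_le`, and
`norm_meanResolvent_sub_le_of_isDiag` for diagonal `Y`). Then `E - Θ` is an exact fixed point at the
parameter `z - R_N(Θ)`. The condition on `Im z` keeps the imaginary part of that parameter above
`δ Im z`, so the Lipschitz bound compares `E` with `G^□(z)` (`norm_sub_fixedPoint_le`).
-/

namespace VarianceProfile

/-! ### Resolvents of Hermitian matrices at diagonal spectral parameters -/

section Resolvent

open Matrix

variable {n : Type*} [Fintype n] [DecidableEq n]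

theorem sum_im_mul_norm_sq {K : Matrix n n ℂ} (hK : K.IsHermitian) (z u : n → ℂ) :
    ∑ i, (z i).im * ‖u i‖ ^ 2 = (star u ⬝ᵥ (diagonal z - K) *ᵥ u).im := by
  have h := hK.im_star_dotProduct_mulVec_self u
  have h' : (star u ⬝ᵥ K *ᵥ u).im = 0 := h
  rw [sub_mulVec, dotProduct_sub, Complex.sub_im, h', sub_zero]
  simp only [dotProduct, mulVec_diagonal, Complex.im_sum, Pi.star_apply]
  refine Finset.sum_congr rfl fun i _ => ?_
  rw [← mul_assoc, mul_comm _ (z i), mul_assoc, RCLike.star_def, Complex.conj_mul']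
  norm_cast
  rw [Complex.im_mul_ofReal]

theorem isUnit_det_diagonal_sub {K : Matrix n n ℂ} (hK : K.IsHermitian) {z : n → ℂ}
    (hz : ∀ i, 0 < (z i).im) : IsUnit (diagonal z - K).det := by
  rw [isUnit_iff_ne_zero]
  intro h
  obtain ⟨u, hu, hMu⟩ := exists_mulVec_eq_zero_iff.mpr h
  have h1 := sum_im_mul_norm_sq hK z u
  rw [hMu, dotProduct_zero, Complex.zero_im] at h1
  apply hu
  funext i
  have h2 := (Finset.sum_eq_zero_iff_of_nonneg
    (fun i _ => mul_nonneg (hz i).le (sq_nonneg ‖u i‖))).mp h1 i (Finset.mem_univ i)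
  simpa [(hz i).ne'] using h2

theorem sum_im_mul_norm_inv_mulVec_sq {K : Matrix n n ℂ} (hK : K.IsHermitian) {z : n → ℂ}
    (hz : ∀ i, 0 < (z i).im) (v : n → ℂ) :
    ∑ i, (z i).im * ‖((diagonal z - K)⁻¹ *ᵥ v) i‖ ^ 2
      = -(star v ⬝ᵥ (diagonal z - K)⁻¹ *ᵥ v).im := by
  rw [sum_im_mul_norm_sq hK, mulVec_mulVec, mul_nonsing_inv _ (isUnit_det_diagonal_sub hK hz),
    one_mulVec, ← Complex.conj_im]
  congr 1
  simp [dotProduct, mul_comm]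

theorem transpose_inv_diagonal_sub (K : Matrix n n ℂ) (z : n → ℂ) :
    (diagonal z - Kᵀ)⁻¹ = ((diagonal z - K)⁻¹)ᵀ := by
  rw [transpose_nonsing_inv, transpose_sub, diagonal_transpose]

/-- Ward identity for the columns of the resolvent. -/
theorem sum_im_mul_norm_inv_col_sq {K : Matrix n n ℂ} (hK : K.IsHermitian) {z : n → ℂ}
    (hz : ∀ i, 0 < (z i).im) (i : n) :
    ∑ j, (z j).im * ‖(diagonal z - K)⁻¹ j i‖ ^ 2 = -((diagonal z - K)⁻¹ i i).im := by
  have h := sum_im_mul_norm_inv_mulVec_sq hK hz (Pi.single i 1)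
  simpa [← Pi.single_star] using h

/-- Ward identity for the rows of the resolvent. -/
theorem sum_im_mul_norm_inv_row_sq {K : Matrix n n ℂ} (hK : K.IsHermitian) {z : n → ℂ}
    (hz : ∀ i, 0 < (z i).im) (i : n) :
    ∑ j, (z j).im * ‖(diagonal z - K)⁻¹ i j‖ ^ 2 = -((diagonal z - K)⁻¹ i i).im := by
  have h := sum_im_mul_norm_inv_col_sq hK.transpose hz i
  simpa only [transpose_inv_diagonal_sub, transpose_apply] using h

theorem inv_diag_im_neg {K : Matrix n n ℂ} (hK : K.IsHermitian) {z : n → ℂ}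
    (hz : ∀ i, 0 < (z i).im) (i : n) : ((diagonal z - K)⁻¹ i i).im < 0 := by
  rw [← neg_pos, ← sum_im_mul_norm_inv_row_sq hK hz i]
  by_contra! h
  have h0 : ∀ j, (diagonal z - K)⁻¹ i j = 0 := by
    intro j
    have h1 := (Finset.sum_eq_zero_iff_of_nonneg
      (fun j _ => mul_nonneg (hz j).le (sq_nonneg ‖(diagonal z - K)⁻¹ i j‖))).mp
      (le_antisymm h (Finset.sum_nonneg fun j _ =>
        mul_nonneg (hz j).le (sq_nonneg ‖(diagonal z - K)⁻¹ i j‖))) j (Finset.mem_univ j)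
    simpa [(hz j).ne'] using h1
  have h2 := congrFun (congrFun (nonsing_inv_mul _ (isUnit_det_diagonal_sub hK hz)) i) i
  simp [mul_apply, h0] at h2

/-- The resolvent is bounded by `1 / η` as an operator, when `Im z ≥ η`. -/
theorem sum_norm_inv_mulVec_sq_le {K : Matrix n n ℂ} (hK : K.IsHermitian) {z : n → ℂ} {η : ℝ}
    (hη : 0 < η) (hz : ∀ i, η ≤ (z i).im) (v : n → ℂ) :
    ∑ i, ‖((diagonal z - K)⁻¹ *ᵥ v) i‖ ^ 2 ≤ (∑ i, ‖v i‖ ^ 2) / η ^ 2 := by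
  set u := (diagonal z - K)⁻¹ *ᵥ v with hu
  have h1 := sum_im_mul_norm_inv_mulVec_sq hK (fun i => hη.trans_le (hz i)) v
  rw [← hu] at h1
  have h2 : η * ∑ i, ‖u i‖ ^ 2 ≤ ∑ i, ‖v i‖ * ‖u i‖ := by
    calc η * ∑ i, ‖u i‖ ^ 2 ≤ ∑ i, (z i).im * ‖u i‖ ^ 2 := by
          rw [Finset.mul_sum]
          exact Finset.sum_le_sum fun i _ => mul_le_mul_of_nonneg_right (hz i) (sq_nonneg _)
      _ = -(star v ⬝ᵥ u).im := h1
      _ ≤ ‖star v ⬝ᵥ u‖ := (neg_le_abs _).trans (Complex.abs_im_le_norm _)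
      _ ≤ ∑ i, ‖v i‖ * ‖u i‖ := by
          refine (norm_sum_le _ _).trans_eq (Finset.sum_congr rfl fun i _ => ?_)
          simp
  have h3 := Finset.sum_mul_sq_le_sq_mul_sq Finset.univ (fun i => ‖v i‖) (fun i => ‖u i‖)
  have hS : 0 ≤ ∑ i, ‖u i‖ ^ 2 := Finset.sum_nonneg fun i _ => sq_nonneg _
  have hV : 0 ≤ ∑ i, ‖v i‖ ^ 2 := Finset.sum_nonneg fun i _ => sq_nonneg _
  generalize ∑ i, ‖u i‖ ^ 2 = S at *
  generalize ∑ i, ‖v i‖ ^ 2 = V at *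
  rw [le_div_iff₀ (by positivity)]
  rcases hS.eq_or_lt with h0 | h0
  · rw [← h0]; simpa using hV
  · have h4 : (η * S) ^ 2 ≤ V * S := (pow_le_pow_left₀ (by positivity) h2 2).trans h3
    have h5 : S * (S * η ^ 2) ≤ S * V := by nlinarith
    exact le_of_mul_le_mul_left h5 h0

theorem sum_norm_inv_col_sq_le {K : Matrix n n ℂ} (hK : K.IsHermitian) {z : n → ℂ} {η : ℝ}
    (hη : 0 < η) (hz : ∀ i, η ≤ (z i).im) (i : n) :
    ∑ j, ‖(diagonal z - K)⁻¹ j i‖ ^ 2 ≤ 1 / η ^ 2 := by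
  have h := sum_norm_inv_mulVec_sq_le hK hη hz (Pi.single i 1)
  have h1 : ∑ j, ‖(Pi.single i 1 : n → ℂ) j‖ ^ 2 = 1 := by
    rw [Finset.sum_eq_single i] <;> simp +contextual
  rw [h1] at h
  simpa using h

theorem sum_norm_inv_row_sq_le {K : Matrix n n ℂ} (hK : K.IsHermitian) {z : n → ℂ} {η : ℝ}
    (hη : 0 < η) (hz : ∀ i, η ≤ (z i).im) (i : n) :
    ∑ j, ‖(diagonal z - K)⁻¹ i j‖ ^ 2 ≤ 1 / η ^ 2 := by
  have h := sum_norm_inv_col_sq_le hK.transpose hη hz i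
  simpa only [transpose_inv_diagonal_sub, transpose_apply] using h

theorem norm_inv_apply_le {K : Matrix n n ℂ} (hK : K.IsHermitian) {z : n → ℂ} {η : ℝ}
    (hη : 0 < η) (hz : ∀ i, η ≤ (z i).im) (i j : n) :
    ‖(diagonal z - K)⁻¹ i j‖ ≤ 1 / η := by
  have h := (Finset.single_le_sum (f := fun j => ‖(diagonal z - K)⁻¹ i j‖ ^ 2)
    (fun j _ => sq_nonneg _) (Finset.mem_univ j)).trans (sum_norm_inv_row_sq_le hK hη hz i)
  refine le_of_sq_le_sq ?_ (by positivity)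
  simpa [div_pow] using h

/-- The resolvent identity for two diagonal spectral parameters. -/
theorem inv_sub_inv_apply {K : Matrix n n ℂ} (hK : K.IsHermitian) {z z' : n → ℂ}
    (hz : ∀ i, 0 < (z i).im) (hz' : ∀ i, 0 < (z' i).im) (i : n) :
    (diagonal z - K)⁻¹ i i - (diagonal z' - K)⁻¹ i i
      = ∑ j, (diagonal z - K)⁻¹ i j * (z' j - z j) * (diagonal z' - K)⁻¹ j i := by
  have h : (diagonal z - K)⁻¹ - (diagonal z' - K)⁻¹
      = (diagonal z - K)⁻¹ * diagonal (z' - z) * (diagonal z' - K)⁻¹ := by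
    have e : diagonal (z' - z) = (diagonal z' - K) - (diagonal z - K) := by
      ext a b
      by_cases hab : a = b <;> simp [hab]
    rw [e, mul_sub, nonsing_inv_mul _ (isUnit_det_diagonal_sub hK hz), sub_mul, mul_assoc,
      mul_nonsing_inv _ (isUnit_det_diagonal_sub hK hz'), mul_one, one_mul]
  have h2 := congrFun (congrFun h i) i
  rw [Matrix.sub_apply] at h2
  rw [h2, mul_apply]
  simp [mul_diagonal]

end Resolvent

/-! ### Contraction of the fixed point map -/

section FixedPoint

open Matrix

variable {N : ℕ} {Γ : Matrix (Fin N) (Fin N) ℝ} {Y : Matrix (Fin N) (Fin N) ℂ}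

theorem fixMap_apply (L D : Fin N → ℂ) (i : Fin N) :
    fixMap Γ Y L D i = (diagonal (L - covMap Γ D) - Y)⁻¹ i i := by
  simp only [fixMap, diag_apply, diagonal_sub]
  rfl

theorem covMap_im (D : Fin N → ℂ) (i : Fin N) :
    (covMap Γ D i).im = ∑ j, Γ i j / N * (D j).im := by
  simp only [covMap, Complex.im_sum]
  refine Finset.sum_congr rfl fun j _ => ?_
  rw [← Complex.ofReal_natCast, ← Complex.ofReal_div, Complex.im_ofReal_mul]

theorem covMap_sub (D D' : Fin N → ℂ) : covMap Γ (D - D') = covMap Γ D - covMap Γ D' := by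
  funext i
  simp [covMap, mul_sub]

theorem norm_covMap_le (hΓ : ∀ i j, 0 ≤ Γ i j) (D : Fin N → ℂ) (i : Fin N) :
    ‖covMap Γ D i‖ ≤ ∑ j, Γ i j / N * ‖D j‖ := by
  refine (norm_sum_le _ _).trans_eq (Finset.sum_congr rfl fun j _ => ?_)
  simp [abs_of_nonneg (hΓ i j)]

theorem covMap_im_nonpos (hΓ : ∀ i j, 0 ≤ Γ i j) {D : Fin N → ℂ} (hD : ∀ i, (D i).im ≤ 0)
    (i : Fin N) : (covMap Γ D i).im ≤ 0 := by
  rw [covMap_im]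
  exact Finset.sum_nonpos fun j _ =>
    mul_nonpos_of_nonneg_of_nonpos (div_nonneg (hΓ i j) N.cast_nonneg) (hD j)

theorem le_sub_covMap_im (hΓ : ∀ i j, 0 ≤ Γ i j) (L : Fin N → ℂ) {D : Fin N → ℂ}
    (hD : ∀ i, (D i).im ≤ 0) (i : Fin N) : (L i).im ≤ ((L - covMap Γ D) i).im := by
  have := covMap_im_nonpos hΓ hD i
  simp only [Pi.sub_apply, Complex.sub_im]
  linarith

theorem fixMap_mem_lowerDiag (hΓ : ∀ i j, 0 ≤ Γ i j) (hY : Y.IsHermitian) {L D : Fin N → ℂ}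
    (hL : L ∈ upperDiag N) (hD : ∀ i, (D i).im ≤ 0) : fixMap Γ Y L D ∈ lowerDiag N := by
  intro i
  rw [fixMap_apply]
  exact inv_diag_im_neg hY (fun j => (hL j).trans_le (le_sub_covMap_im hΓ L hD j)) i

theorem norm_fixMap_le (hΓ : ∀ i j, 0 ≤ Γ i j) (hY : Y.IsHermitian) {L D : Fin N → ℂ} {η : ℝ}
    (hη : 0 < η) (hL : ∀ i, η ≤ (L i).im) (hD : ∀ i, (D i).im ≤ 0) (i : Fin N) :
    ‖fixMap Γ Y L D i‖ ≤ 1 / η := by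
  rw [fixMap_apply]
  exact norm_inv_apply_le hY hη (fun j => (hL j).trans (le_sub_covMap_im hΓ L hD j)) i i

theorem sqrt_mul_add_sqrt_mul_le {a b c d : ℝ} (ha : 0 ≤ a) (hb : 0 ≤ b) (hc : 0 ≤ c)
    (hd : 0 ≤ d) : √(a * c) + √(b * d) ≤ √((a + b) * (c + d)) := by
  apply Real.le_sqrt_of_sq_le
  have h1 := Real.sq_sqrt (mul_nonneg ha hc)
  have h2 := Real.sq_sqrt (mul_nonneg hb hd)
  have h3 : √(a * c) * √(b * d) = √(a * d) * √(b * c) := by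
    rw [← Real.sqrt_mul (mul_nonneg ha hc), ← Real.sqrt_mul (mul_nonneg ha hd)]
    congr 1; ring
  have h4 := Real.sq_sqrt (mul_nonneg ha hd)
  have h5 := Real.sq_sqrt (mul_nonneg hb hc)
  nlinarith [sq_nonneg (√(a * d) - √(b * c))]

theorem sum_mul_sqrt_mul_le {ι : Type*} (s : Finset ι) {w f g : ι → ℝ} (hw : ∀ i, 0 ≤ w i)
    (hf : ∀ i, 0 ≤ f i) (hg : ∀ i, 0 ≤ g i) :
    ∑ i ∈ s, w i * √(f i * g i) ≤ √((∑ i ∈ s, w i * f i) * ∑ i ∈ s, w i * g i) := by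
  rw [Real.sqrt_mul (Finset.sum_nonneg fun i _ => mul_nonneg (hw i) (hf i))]
  refine le_trans (le_of_eq (Finset.sum_congr rfl fun i _ => ?_))
    (Real.sum_sqrt_mul_sqrt_le s (fun i => mul_nonneg (hw i) (hf i))
      (fun i => mul_nonneg (hw i) (hg i)))
  rw [← Real.sqrt_mul (mul_nonneg (hw i) (hf i)),
    show w i * f i * (w i * g i) = w i ^ 2 * (f i * g i) by ring,
    Real.sqrt_mul (sq_nonneg _), Real.sqrt_sq (hw i)]

/-- The map `D ↦ Δ[(L - R_N(D) - Y)⁻¹]` contracts the weighted distance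
`maxₖ ‖Dₖ - D'ₖ‖ / √(Im Dₖ Im D'ₖ)`, an analogue of the hyperbolic distance on the half-plane. The
resolvent identity expresses the difference of the two values through the products
`(M⁻¹)ᵢⱼ (M'⁻¹)ⱼᵢ`, and the Cauchy-Schwarz inequality followed by the Ward identities bounds it by the
weights at the image points. The parameter `κ` measures `L - L'` in the same way, and `q` is the
contraction factor. -/
theorem norm_fixMap_sub_le (hΓ : ∀ i j, 0 ≤ Γ i j) (hY : Y.IsHermitian)
    {L L' D D' : Fin N → ℂ} (hL : L ∈ upperDiag N) (hL' : L' ∈ upperDiag N)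
    (hD : ∀ i, (D i).im ≤ 0) (hD' : ∀ i, (D' i).im ≤ 0) {c κ q : ℝ} (hκ : 0 ≤ κ) (hκc : κ ≤ c)
    (hq : 0 ≤ q)
    (hDD : ∀ i, ‖D i - D' i‖ ≤ c * √(-(D i).im * -(D' i).im))
    (hLL : ∀ i, ‖L i - L' i‖ ≤ κ * √((L i).im * (L' i).im))
    (hqD : ∀ i, -(covMap Γ D i).im ≤ q * ((L - covMap Γ D) i).im)
    (hqD' : ∀ i, -(covMap Γ D' i).im ≤ q * ((L' - covMap Γ D') i).im) (i : Fin N) :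
    ‖fixMap Γ Y L D i - fixMap Γ Y L' D' i‖
      ≤ (κ + q * (c - κ)) * √(-(fixMap Γ Y L D i).im * -(fixMap Γ Y L' D' i).im) := by
  have hz := fun j => (hL j).trans_le (le_sub_covMap_im hΓ L hD j)
  have hz' := fun j => (hL' j).trans_le (le_sub_covMap_im hΓ L' hD' j)
  have hc : 0 ≤ c := hκ.trans hκc
  have hs : 0 ≤ κ + q * (c - κ) := by nlinarith [mul_nonneg hq (sub_nonneg.mpr hκc)]
  set z := L - covMap Γ D with hzdef
  set z' := L' - covMap Γ D' with hzdef'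
  have key : ∀ j, ‖z' j - z j‖ ≤ (κ + q * (c - κ)) * √((z j).im * (z' j).im) := by
    intro j
    set p := -(covMap Γ D j).im with hp
    set p' := -(covMap Γ D' j).im with hp'
    have hp0 : 0 ≤ p := neg_nonneg.mpr (covMap_im_nonpos hΓ hD j)
    have hp0' : 0 ≤ p' := neg_nonneg.mpr (covMap_im_nonpos hΓ hD' j)
    have e1 : (z j).im = (L j).im + p := by simp [hzdef, hp]; ring
    have e2 : (z' j).im = (L' j).im + p' := by simp [hzdef', hp']; ring
    have h1 : ‖covMap Γ (D - D') j‖ ≤ c * √(p * p') := by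
      calc ‖covMap Γ (D - D') j‖ ≤ ∑ k, Γ j k / N * ‖(D - D') k‖ := norm_covMap_le hΓ _ _
        _ ≤ ∑ k, Γ j k / N * (c * √(-(D k).im * -(D' k).im)) :=
            Finset.sum_le_sum fun k _ => mul_le_mul_of_nonneg_left (hDD k)
              (div_nonneg (hΓ j k) N.cast_nonneg)
        _ = c * ∑ k, Γ j k / N * √(-(D k).im * -(D' k).im) := by
            rw [Finset.mul_sum]
            exact Finset.sum_congr rfl fun k _ => by ring
        _ ≤ c * √((∑ k, Γ j k / N * -(D k).im) * ∑ k, Γ j k / N * -(D' k).im) :=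
            mul_le_mul_of_nonneg_left (sum_mul_sqrt_mul_le _
              (fun k => div_nonneg (hΓ j k) N.cast_nonneg) (fun k => neg_nonneg.mpr (hD k))
              (fun k => neg_nonneg.mpr (hD' k))) hc
        _ = c * √(p * p') := by simp only [hp, hp', covMap_im, mul_neg, Finset.sum_neg_distrib]
    have h2 : √(p * p') ≤ q * √((z j).im * (z' j).im) := by
      rw [← Real.sqrt_sq hq, ← Real.sqrt_mul (sq_nonneg q)]
      refine Real.sqrt_le_sqrt ((mul_le_mul (hqD j) (hqD' j) hp0' ?_).trans_eq (by ring))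
      exact mul_nonneg hq (hz j).le
    have h3 : √(p * p') + √((L j).im * (L' j).im) ≤ √((z j).im * (z' j).im) := by
      rw [e1, e2, add_comm]
      exact sqrt_mul_add_sqrt_mul_le (hL j).le hp0 (hL' j).le hp0'
    have e3 : z' j - z j = covMap Γ (D - D') j - (L j - L' j) := by
      rw [covMap_sub]; simp only [hzdef, hzdef', Pi.sub_apply]; ring
    rw [e3]
    calc _ ≤ c * √(p * p') + κ * √((L j).im * (L' j).im) :=
          (norm_sub_le _ _).trans (add_le_add h1 (hLL j))
      _ = (c - κ) * √(p * p') + κ * (√(p * p') + √((L j).im * (L' j).im)) := by ring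
      _ ≤ (c - κ) * (q * √((z j).im * (z' j).im)) + κ * √((z j).im * (z' j).im) :=
          add_le_add (mul_le_mul_of_nonneg_left h2 (sub_nonneg.mpr hκc))
            (mul_le_mul_of_nonneg_left h3 hκ)
      _ = _ := by ring
  simp only [fixMap_apply]
  rw [← hzdef, ← hzdef', inv_sub_inv_apply hY hz hz' i]
  set R := (diagonal z - Y)⁻¹
  set R' := (diagonal z' - Y)⁻¹
  calc ‖∑ j, R i j * (z' j - z j) * R' j i‖
      ≤ ∑ j, (κ + q * (c - κ)) * (√((z j).im * ‖R i j‖ ^ 2) * √((z' j).im * ‖R' j i‖ ^ 2)) := by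
        refine (norm_sum_le _ _).trans (Finset.sum_le_sum fun j _ => ?_)
        rw [norm_mul, norm_mul, Real.sqrt_mul (hz j).le, Real.sqrt_mul (hz' j).le,
          Real.sqrt_sq (norm_nonneg _), Real.sqrt_sq (norm_nonneg _)]
        have := key j
        rw [Real.sqrt_mul (hz j).le] at this
        calc _ ≤ ‖R i j‖ * ((κ + q * (c - κ)) * (√(z j).im * √(z' j).im)) * ‖R' j i‖ := by gcongr
          _ = _ := by ring
    _ ≤ (κ + q * (c - κ)) *
        (√(∑ j, (z j).im * ‖R i j‖ ^ 2) * √(∑ j, (z' j).im * ‖R' j i‖ ^ 2)) := by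
        rw [← Finset.mul_sum]
        exact mul_le_mul_of_nonneg_left (Real.sum_sqrt_mul_sqrt_le _
          (fun j => mul_nonneg (hz j).le (sq_nonneg _))
          (fun j => mul_nonneg (hz' j).le (sq_nonneg _))) hs
    _ = _ := by
        rw [sum_im_mul_norm_inv_row_sq hY hz i, sum_im_mul_norm_inv_col_sq hY hz' i,
          Real.sqrt_mul (neg_nonneg.mpr (inv_diag_im_neg hY hz i).le)]

end FixedPoint

/-! ### Regularity of the resolvent in the spectral parameter -/

section Regularity

open Matrix Filter Topology

attribute [local instance] Matrix.linftyOpNormedRing Matrix.linftyOpNormedAlgebra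

variable {n : Type*} [Fintype n] [DecidableEq n]

theorem differentiableAt_inv_apply {K : Matrix n n ℂ} (hK : K.IsHermitian) {Z : ℂ → n → ℂ} {w : ℂ}
    (hZ : DifferentiableAt ℂ Z w) (hw : ∀ i, 0 < (Z w i).im) (i j : n) :
    DifferentiableAt ℂ (fun t => (diagonal (Z t) - K)⁻¹ i j) w := by
  have hu : IsUnit (diagonal (Z w) - K) :=
    (isUnit_iff_isUnit_det _).mpr (isUnit_det_diagonal_sub hK hw)
  have h1 : DifferentiableAt ℂ (fun t => diagonal (Z t) - K) w :=
    (((diagonalLinearMap n ℂ ℂ).toContinuousLinearMap.differentiableAt).comp w hZ).sub_const K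
  have h2 : DifferentiableAt ℂ (fun t => (diagonal (Z t) - K)⁻¹) w := by
    simp only [nonsing_inv_eq_ringInverse]
    exact (differentiableAt_inverse hu).comp w h1
  exact ((entryLinearMap ℂ ℂ i j).toContinuousLinearMap.differentiableAt).comp w h2

theorem tendsto_inv_apply {α : Type*} {l : Filter α} {K : Matrix n n ℂ} (hK : K.IsHermitian)
    {Z : α → n → ℂ} {z : n → ℂ} (hZ : Tendsto Z l (𝓝 z)) (hz : ∀ i, 0 < (z i).im) (i j : n) :
    Tendsto (fun a => (diagonal (Z a) - K)⁻¹ i j) l (𝓝 ((diagonal z - K)⁻¹ i j)) := by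
  have hu : IsUnit (diagonal z - K) :=
    (isUnit_iff_isUnit_det _).mpr (isUnit_det_diagonal_sub hK hz)
  have h1 : ContinuousAt (fun z : n → ℂ => diagonal z - K) z := by fun_prop
  have h2 : ContinuousAt (fun z : n → ℂ => (diagonal z - K)⁻¹) z := by
    simp only [nonsing_inv_eq_ringInverse]
    exact ContinuousAt.comp (f := fun z : n → ℂ => diagonal z - K) (g := Ring.inverse)
      (differentiableAt_inverse (𝕜 := ℂ) hu).continuousAt h1
  have h3 : ContinuousAt (fun A : Matrix n n ℂ => A i j) ((diagonal z - K)⁻¹) :=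
    (entryLinearMap ℂ ℂ i j).toContinuousLinearMap.continuous.continuousAt
  exact (h3.tendsto.comp h2.tendsto).comp hZ

end Regularity

/-! ### Existence, uniqueness and analyticity of the fixed point -/

section Existence

open Matrix Filter Topology

variable {N : ℕ} {Γ : Matrix (Fin N) (Fin N) ℝ} {Y : Matrix (Fin N) (Fin N) ℂ}

theorem exists_neg_covMap_im_le (hΓ : ∀ i j, 0 ≤ Γ i j) {η B : ℝ} (hη : 0 < η) (hB : 0 ≤ B) :
    ∃ q : ℝ, 0 ≤ q ∧ q < 1 ∧ ∀ L D : Fin N → ℂ, (∀ i, η ≤ (L i).im) → (∀ i, -(D i).im ≤ B) →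
      ∀ i, -(covMap Γ D i).im ≤ q * ((L - covMap Γ D) i).im := by
  set C := ∑ i, ∑ j, Γ i j / N with hCdef
  have hC : 0 ≤ C := Finset.sum_nonneg fun i _ => Finset.sum_nonneg fun j _ =>
    div_nonneg (hΓ i j) N.cast_nonneg
  have hBC := mul_nonneg hB hC
  refine ⟨B * C / (η + B * C), by positivity, by rw [div_lt_one (by positivity)]; linarith, ?_⟩
  intro L D hL hD i
  have hp : -(covMap Γ D i).im ≤ B * C := by
    rw [covMap_im, ← Finset.sum_neg_distrib]
    calc ∑ j, -(Γ i j / N * (D j).im) ≤ ∑ j, B * (Γ i j / N) := by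
          refine Finset.sum_le_sum fun j _ => ?_
          have := mul_le_mul_of_nonneg_left (hD j) (div_nonneg (hΓ i j) N.cast_nonneg)
          linarith
      _ ≤ B * C := by
          rw [← Finset.mul_sum]
          exact mul_le_mul_of_nonneg_left (Finset.single_le_sum
            (f := fun i => ∑ j, Γ i j / (N : ℝ)) (fun i _ => Finset.sum_nonneg fun j _ =>
              div_nonneg (hΓ i j) N.cast_nonneg) (Finset.mem_univ i)) hB
  rw [div_mul_eq_mul_div, le_div_iff₀ (by positivity), Pi.sub_apply, Complex.sub_im]
  nlinarith [hL i, mul_le_mul_of_nonneg_left (hL i) hBC]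

/-- Fixed points in the lower half-space depend on the parameter `L` in a Lipschitz way. If the
weighted distance `c` of `D` and `D'` exceeded `κ`, then the contraction estimate would give
`c ≤ κ + q (c - κ) < c`. -/
theorem norm_sub_le_of_fixedPoints (hΓ : ∀ i j, 0 ≤ Γ i j) (hY : Y.IsHermitian)
    {L L' D D' : Fin N → ℂ} (hL : L ∈ upperDiag N) (hL' : L' ∈ upperDiag N)
    (hD : D ∈ lowerDiag N) (hD' : D' ∈ lowerDiag N) (hfix : D = fixMap Γ Y L D)
    (hfix' : D' = fixMap Γ Y L' D') {κ : ℝ} (hκ : 0 ≤ κ)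
    (hLL : ∀ i, ‖L i - L' i‖ ≤ κ * √((L i).im * (L' i).im)) (i : Fin N) :
    ‖D i - D' i‖ ≤ κ * √(-(D i).im * -(D' i).im) := by
  have : Nonempty (Fin N) := ⟨i⟩
  have hpos : ∀ k, 0 < √(-(D k).im * -(D' k).im) := fun k =>
    Real.sqrt_pos.mpr (mul_pos (neg_pos.mpr (hD k)) (neg_pos.mpr (hD' k)))
  obtain ⟨k, hk⟩ := Finite.exists_max fun k => ‖D k - D' k‖ / √(-(D k).im * -(D' k).im)
  set c := ‖D k - D' k‖ / √(-(D k).im * -(D' k).im) with hc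
  have hDD : ∀ j, ‖D j - D' j‖ ≤ c * √(-(D j).im * -(D' j).im) := fun j =>
    (div_le_iff₀ (hpos j)).mp (hk j)
  suffices hcκ : c ≤ κ from
    (hDD i).trans (mul_le_mul_of_nonneg_right hcκ (hpos i).le)
  by_contra! hlt
  obtain ⟨a, ha⟩ := Finite.exists_min fun j => min (L j).im (L' j).im
  obtain ⟨b, hb⟩ := Finite.exists_max fun j => max (-(D j).im) (-(D' j).im)
  obtain ⟨q, hq0, hq1, hq⟩ := exists_neg_covMap_im_le (N := N) hΓ
    (η := min (L a).im (L' a).im) (B := max (-(D b).im) (-(D' b).im))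
    (lt_min (hL a) (hL' a)) (le_max_of_le_left (neg_pos.mpr (hD b)).le)
  have h := norm_fixMap_sub_le hΓ hY hL hL' (fun j => (hD j).le) (fun j => (hD' j).le) hκ hlt.le hq0
    hDD hLL
    (hq L D (fun j => (ha j).trans (min_le_left _ _)) (fun j => (le_max_left _ _).trans (hb j)))
    (hq L' D' (fun j => (ha j).trans (min_le_right _ _))
      (fun j => (le_max_right _ _).trans (hb j))) k
  rw [← hfix, ← hfix'] at h
  have h2 : c ≤ κ + q * (c - κ) := (div_le_iff₀ (hpos k)).mpr h
  nlinarith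

theorem fixedPoint_unique (hΓ : ∀ i j, 0 ≤ Γ i j) (hY : Y.IsHermitian)
    {L D D' : Fin N → ℂ} (hL : L ∈ upperDiag N)
    (hD : D ∈ lowerDiag N) (hD' : D' ∈ lowerDiag N) (hfix : D = fixMap Γ Y L D)
    (hfix' : D' = fixMap Γ Y L D') : D = D' := by
  funext i
  have h := norm_sub_le_of_fixedPoints hΓ hY hL hL hD hD' hfix hfix' le_rfl (by simp) i
  rw [zero_mul, norm_le_zero_iff, sub_eq_zero] at h
  exact h

/-- The fixed point iteration of `D ↦ Δ[(L - R_N(D) - Y)⁻¹]` started at `-i`. -/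
noncomputable def fixIter (Γ : Matrix (Fin N) (Fin N) ℝ) (Y : Matrix (Fin N) (Fin N) ℂ)
    (L : Fin N → ℂ) (m : ℕ) : Fin N → ℂ :=
  (fixMap Γ Y L)^[m] fun _ => -Complex.I

theorem fixIter_succ (L : Fin N → ℂ) (m : ℕ) :
    fixIter Γ Y L (m + 1) = fixMap Γ Y L (fixIter Γ Y L m) :=
  Function.iterate_succ_apply' _ _ _

theorem fixIter_mem_lowerDiag (hΓ : ∀ i j, 0 ≤ Γ i j) (hY : Y.IsHermitian) {L : Fin N → ℂ}
    (hL : L ∈ upperDiag N) (m : ℕ) : fixIter Γ Y L m ∈ lowerDiag N := by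
  induction m with
  | zero => intro i; simp [fixIter]
  | succ m ih =>
    rw [fixIter_succ]
    exact fixMap_mem_lowerDiag hΓ hY hL fun i => (ih i).le

theorem norm_fixIter_le (hΓ : ∀ i j, 0 ≤ Γ i j) (hY : Y.IsHermitian) {L : Fin N → ℂ} {η : ℝ}
    (hη : 0 < η) (hL : ∀ i, η ≤ (L i).im) (m : ℕ) (i : Fin N) :
    ‖fixIter Γ Y L m i‖ ≤ max 1 (1 / η) := by
  cases m with
  | zero => simp [fixIter]
  | succ m =>
    rw [fixIter_succ]
    exact (norm_fixMap_le hΓ hY hη hL (fun i => (fixIter_mem_lowerDiag hΓ hY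
      (fun i => hη.trans_le (hL i)) m i).le) i).trans (le_max_right _ _)

/-- Geometric convergence of the fixed point iteration, with a rate that is uniform over all `L` with
`Im L ≥ η`. After the first step the iterates are bounded, which keeps the contraction factor away
from `1`. -/
theorem exists_dist_fixIter_le (hΓ : ∀ i j, 0 ≤ Γ i j) (hY : Y.IsHermitian) {η c : ℝ}
    (hη : 0 < η) (hc : 0 ≤ c) : ∃ q : ℝ, 0 ≤ q ∧ q < 1 ∧ ∀ L : Fin N → ℂ, (∀ i, η ≤ (L i).im) →
      (∀ i, ‖fixIter Γ Y L 0 i - fixIter Γ Y L 1 i‖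
        ≤ c * √(-(fixIter Γ Y L 0 i).im * -(fixIter Γ Y L 1 i).im)) →
      ∀ m i, dist (fixIter Γ Y L m i) (fixIter Γ Y L (m + 1) i) ≤ c * max 1 (1 / η) * q ^ m := by
  obtain ⟨q, hq0, hq1, hq⟩ := exists_neg_covMap_im_le (N := N) hΓ hη
    (B := max 1 (1 / η)) (by positivity)
  refine ⟨q, hq0, hq1, fun L hL h0 m i => ?_⟩
  have hLu : L ∈ upperDiag N := fun i => hη.trans_le (hL i)
  have hlow := fixIter_mem_lowerDiag hΓ hY hLu
  have hle : ∀ m i, -(fixIter Γ Y L m i).im ≤ max 1 (1 / η) := fun m i =>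
    ((neg_le_abs _).trans (Complex.abs_im_le_norm _)).trans (norm_fixIter_le hΓ hY hη hL m i)
  have key : ∀ m i, ‖fixIter Γ Y L m i - fixIter Γ Y L (m + 1) i‖
      ≤ c * q ^ m * √(-(fixIter Γ Y L m i).im * -(fixIter Γ Y L (m + 1) i).im) := by
    intro m
    induction m with
    | zero => simpa using h0
    | succ m ih =>
      intro i
      have h := norm_fixMap_sub_le hΓ hY hLu hLu (fun j => (hlow m j).le)
        (fun j => (hlow (m + 1) j).le) le_rfl (by positivity : 0 ≤ c * q ^ m) hq0 ih (by simp)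
        (hq L _ hL (hle m)) (hq L _ hL (hle (m + 1))) i
      rw [← fixIter_succ, ← fixIter_succ] at h
      refine h.trans_eq ?_
      ring
  rw [dist_eq_norm]
  refine (key m i).trans ?_
  have h1 : √(-(fixIter Γ Y L m i).im * -(fixIter Γ Y L (m + 1) i).im) ≤ max 1 (1 / η) := by
    rw [Real.sqrt_le_left (by positivity), sq]
    exact mul_le_mul (hle m i) (hle _ i) (neg_pos.mpr (hlow _ i)).le (by positivity)
  calc _ ≤ c * q ^ m * max 1 (1 / η) := mul_le_mul_of_nonneg_left h1 (by positivity)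
    _ = _ := by ring

theorem exists_norm_fixIter_zero_sub_le (hΓ : ∀ i j, 0 ≤ Γ i j) (hY : Y.IsHermitian)
    {Z : ℂ → Fin N → ℂ} {S : Set ℂ} (hS : IsCompact S) (hcont : ∀ i, ContinuousOn (fun t =>
      fixIter Γ Y (Z t) 1 i) S) (hup : ∀ t ∈ S, Z t ∈ upperDiag N) :
    ∃ c : ℝ, 0 ≤ c ∧ ∀ t ∈ S, ∀ i, ‖fixIter Γ Y (Z t) 0 i - fixIter Γ Y (Z t) 1 i‖
        ≤ c * √(-(fixIter Γ Y (Z t) 0 i).im * -(fixIter Γ Y (Z t) 1 i).im) := by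
  have h : ∀ i, ∃ c : ℝ, 0 ≤ c ∧ ∀ t ∈ S, ‖fixIter Γ Y (Z t) 0 i - fixIter Γ Y (Z t) 1 i‖
        ≤ c * √(-(fixIter Γ Y (Z t) 0 i).im * -(fixIter Γ Y (Z t) 1 i).im) := by
    intro i
    have hpos : ∀ t ∈ S, 0 < √(-(fixIter Γ Y (Z t) 0 i).im * -(fixIter Γ Y (Z t) 1 i).im) :=
      fun t ht => Real.sqrt_pos.mpr (mul_pos
        (neg_pos.mpr (fixIter_mem_lowerDiag hΓ hY (hup t ht) 0 i))
        (neg_pos.mpr (fixIter_mem_lowerDiag hΓ hY (hup t ht) 1 i)))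
    have hc0 : ContinuousOn (fun t => fixIter Γ Y (Z t) 0 i) S := by
      simp only [fixIter, Function.iterate_zero, id]
      exact continuousOn_const
    have hc : ContinuousOn (fun t => ‖fixIter Γ Y (Z t) 0 i - fixIter Γ Y (Z t) 1 i‖ /
        √(-(fixIter Γ Y (Z t) 0 i).im * -(fixIter Γ Y (Z t) 1 i).im)) S := by
      refine ((hc0.sub (hcont i)).norm).div (ContinuousOn.sqrt ?_) fun t ht => (hpos t ht).ne'
      exact ((Complex.continuous_im.comp_continuousOn hc0).neg).mul
        ((Complex.continuous_im.comp_continuousOn (hcont i)).neg)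
    obtain ⟨C, hC⟩ := hS.exists_bound_of_continuousOn hc
    refine ⟨max C 0, le_max_right _ _, fun t ht => ?_⟩
    rw [← div_le_iff₀ (hpos t ht)]
    exact ((le_abs_self _).trans (hC t ht)).trans (le_max_left _ _)
  choose c hc0 hc using h
  refine ⟨∑ i, c i, Finset.sum_nonneg fun i _ => hc0 i, fun t ht i => (hc i t ht).trans ?_⟩
  exact mul_le_mul_of_nonneg_right (Finset.single_le_sum (fun i _ => hc0 i) (Finset.mem_univ i))
    (Real.sqrt_nonneg _)

/-- The limit of the iteration lies a priori only in the closed lower half-space; it lies in the open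
one because it is a value of `fixMap`. -/
theorem exists_tendsto_fixIter (hΓ : ∀ i j, 0 ≤ Γ i j) (hY : Y.IsHermitian) {L : Fin N → ℂ}
    (hL : L ∈ upperDiag N) : ∃ D : Fin N → ℂ, Tendsto (fixIter Γ Y L) atTop (𝓝 D) ∧
      D ∈ lowerDiag N ∧ D = fixMap Γ Y L D := by
  have hη : ∃ η : ℝ, 0 < η ∧ ∀ i, η ≤ (L i).im := by
    rcases isEmpty_or_nonempty (Fin N) with h | h
    · exact ⟨1, one_pos, fun i => h.elim i⟩
    · obtain ⟨a, ha⟩ := Finite.exists_min fun j => (L j).im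
      exact ⟨_, hL a, ha⟩
  obtain ⟨η, hη, hηL⟩ := hη
  obtain ⟨c, hc0, hc⟩ := exists_norm_fixIter_zero_sub_le (Γ := Γ) (Y := Y) hΓ hY (Z := fun _ => L)
    (isCompact_singleton (x := (0 : ℂ))) (fun i => continuousOn_const) (fun _ _ => hL)
  obtain ⟨q, -, hq1, hq⟩ := exists_dist_fixIter_le (Γ := Γ) (Y := Y) hΓ hY hη hc0
  have hlim : ∀ i, ∃ d, Tendsto (fun m => fixIter Γ Y L m i) atTop (𝓝 d) := fun i =>
    cauchySeq_tendsto_of_complete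
      (cauchySeq_of_le_geometric q _ hq1 fun m => hq L hηL (hc 0 rfl) m i)
  choose D hD using hlim
  have hDt : Tendsto (fixIter Γ Y L) atTop (𝓝 D) := tendsto_pi_nhds.mpr hD
  have hDle : ∀ i, (D i).im ≤ 0 := fun i =>
    le_of_tendsto ((Complex.continuous_im.tendsto _).comp (hD i))
      (Eventually.of_forall fun m => (fixIter_mem_lowerDiag hΓ hY hL m i).le)
  have hfix : D = fixMap Γ Y L D := by
    funext i
    refine tendsto_nhds_unique ((hD i).comp (tendsto_add_atTop_nat 1)) ?_
    have hcov : Continuous fun D : Fin N → ℂ => L - covMap Γ D := by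
      unfold covMap; fun_prop
    have := tendsto_inv_apply hY ((hcov.tendsto D).comp hDt)
      (fun i => (hL i).trans_le (le_sub_covMap_im hΓ L hDle i)) i i
    simp only [fixMap_apply]
    refine this.congr fun m => ?_
    simp only [Function.comp, fixIter_succ, fixMap_apply]
  exact ⟨D, hDt, hfix ▸ fixMap_mem_lowerDiag hΓ hY hL hDle, hfix⟩

theorem differentiableAt_fixIter (hΓ : ∀ i j, 0 ≤ Γ i j) (hY : Y.IsHermitian) {Z : ℂ → Fin N → ℂ}
    {w : ℂ} (hZ : DifferentiableAt ℂ Z w) (hup : Z w ∈ upperDiag N) (m : ℕ) :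
    DifferentiableAt ℂ (fun t => fixIter Γ Y (Z t) m) w := by
  induction m with
  | zero => simp only [fixIter, Function.iterate_zero, id]; exact differentiableAt_const _
  | succ m ih =>
    rw [differentiableAt_pi]
    intro i
    simp only [fixIter_succ, fixMap_apply]
    refine differentiableAt_inv_apply hY (hZ.sub ?_) (fun j => (hup j).trans_le
      (le_sub_covMap_im hΓ _ (fun j => (fixIter_mem_lowerDiag hΓ hY hup m j).le) j)) i i
    rw [differentiableAt_pi] at ih ⊢
    intro j
    simp only [covMap]
    exact DifferentiableAt.fun_sum fun k _ => (ih k).const_mul _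

theorem exists_isDetEquiv (hΓ : ∀ i j, 0 ≤ Γ i j) (hY : Y.IsHermitian) :
    ∃ G : (Fin N → ℂ) → (Fin N → ℂ), IsDetEquiv Γ Y G := by
  have h : ∀ L : Fin N → ℂ, ∃ D : Fin N → ℂ, L ∈ upperDiag N →
      Tendsto (fixIter Γ Y L) atTop (𝓝 D) ∧ D ∈ lowerDiag N ∧ D = fixMap Γ Y L D := by
    intro L
    by_cases hL : L ∈ upperDiag N
    · obtain ⟨D, hD⟩ := exists_tendsto_fixIter hΓ hY hL
      exact ⟨D, fun _ => hD⟩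
    · exact ⟨0, fun h => (hL h).elim⟩
  choose G hG using h
  refine ⟨G, ⟨fun L hL => (hG L hL).2.1, fun L hL i k => ?_, fun L hL => (hG L hL).2.2⟩⟩
  set U : Set ℂ := {t | 0 < t.im} with hU
  have hUo : IsOpen U := isOpen_lt continuous_const Complex.continuous_im
  have hup : ∀ t ∈ U, Function.update L i t ∈ upperDiag N := by
    intro t ht j
    by_cases hj : j = i
    · subst hj; simpa [hU] using ht
    · simpa [hj] using hL j
  have hdiffZ : Differentiable ℂ fun t : ℂ => Function.update L i t := by
    rw [differentiable_pi]
    intro j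
    by_cases hj : j = i
    · subst hj; simp
    · simp [hj]
  have hdiff : ∀ m j, DifferentiableOn ℂ (fun t => fixIter Γ Y (Function.update L i t) m j) U :=
    fun m j t ht => (differentiableAt_pi.mp
      (differentiableAt_fixIter hΓ hY (hdiffZ t) (hup t ht) m) j).differentiableWithinAt
  have hloc : TendstoLocallyUniformlyOn
      (fun m t => fixIter Γ Y (Function.update L i t) m k)
      (fun t => G (Function.update L i t) k) atTop U := by
    rw [tendstoLocallyUniformlyOn_iff_forall_isCompact hUo]
    intro S hSU hS
    have hη : ∃ η : ℝ, 0 < η ∧ ∀ t ∈ S, ∀ j, η ≤ (Function.update L i t j).im := by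
      have hj : ∀ j, ∃ η : ℝ, 0 < η ∧ ∀ t ∈ S, η ≤ (Function.update L i t j).im := fun j =>
        hS.exists_forall_le' ((Complex.continuous_im.comp
          ((continuous_apply j).comp hdiffZ.continuous)).continuousOn)
          (fun t ht => hup t (hSU ht) j)
      choose η h0 h1 using hj
      obtain ⟨a, ha⟩ := @Finite.exists_min _ _ _ ⟨i⟩ _ η
      exact ⟨η a, h0 a, fun t ht j => (ha j).trans (h1 j t ht)⟩
    obtain ⟨η, hη, hηS⟩ := hη
    obtain ⟨c, hc0, hc⟩ := exists_norm_fixIter_zero_sub_le (Γ := Γ) (Y := Y) hΓ hY hS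
      (fun j => (hdiff 1 j).continuousOn.mono hSU) (fun t ht => hup t (hSU ht))
    obtain ⟨q, hq0, hq1, hq⟩ := exists_dist_fixIter_le (Γ := Γ) (Y := Y) hΓ hY hη hc0
    rw [Metric.tendstoUniformlyOn_iff]
    intro ε hε
    have hlim : Tendsto (fun m => c * max 1 (1 / η) * q ^ m / (1 - q)) atTop (𝓝 0) := by
      have := ((tendsto_pow_atTop_nhds_zero_of_lt_one hq0 hq1).const_mul
        (c * max 1 (1 / η))).div_const (1 - q)
      simpa using this
    filter_upwards [hlim.eventually (gt_mem_nhds hε)] with m hm t ht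
    rw [dist_comm]
    exact (dist_le_of_le_geometric_of_tendsto q _ hq1
      (fun m => hq _ (hηS t ht) (hc t ht) m k)
      ((tendsto_pi_nhds.mp (hG _ (hup t (hSU ht))).1) k) m).trans_lt hm
  exact (hloc.differentiableOn (Eventually.of_forall fun m => hdiff m k) hUo).analyticAt
    (hUo.mem_nhds (hL i))

end Existence

/-! ### Gaussian integration by parts -/

section GaussianIntegrationByParts

theorem hasDerivAt_gaussianPDFReal (t : ℝ) :
    HasDerivAt (gaussianPDFReal 0 1) (-t * gaussianPDFReal 0 1 t) t := by
  have h : HasDerivAt (fun x : ℝ => -(x - 0) ^ 2 / (2 * ((1 : NNReal) : ℝ))) (-t) t := by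
    have := (((hasDerivAt_id t).sub_const 0).pow 2).neg.div_const (2 * ((1 : NNReal) : ℝ))
    refine this.congr_deriv ?_
    simp
    ring
  have h2 := h.exp.const_mul ((√(2 * Real.pi * ((1 : NNReal) : ℝ)))⁻¹)
  rw [gaussianPDFReal_def]
  refine h2.congr_deriv ?_
  simp only
  ring

theorem integrable_gaussianReal_id : Integrable (fun t : ℝ => t) (gaussianReal 0 1) :=
  (memLp_id_gaussianReal (μ := 0) (v := 1) 1).integrable le_rfl

/-- One-dimensional Gaussian integration by parts (Stein's identity). -/
theorem integral_id_mul_gaussianReal {f f' : ℝ → ℂ} (hf : ∀ t, HasDerivAt f (f' t) t)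
    (hf' : Continuous f') {C : ℝ} (hC : ∀ t, ‖f t‖ ≤ C) (hC' : ∀ t, ‖f' t‖ ≤ C) :
    ∫ t, (t : ℂ) * f t ∂gaussianReal 0 1 = ∫ t, f' t ∂gaussianReal 0 1 := by
  have hfc : Continuous f := continuous_iff_continuousAt.mpr fun t => (hf t).continuousAt
  have hp : Integrable (fun t => ((gaussianPDFReal 0 1 t : ℝ) : ℂ)) :=
    (integrable_gaussianPDFReal 0 1).ofReal
  have hp' : Integrable (fun t => ((-t * gaussianPDFReal 0 1 t : ℝ) : ℂ)) := by
    suffices h : Integrable fun t : ℝ => -t * gaussianPDFReal 0 1 t from h.ofReal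
    have h := integrable_mul_exp_neg_mul_sq (b := 1 / 2) (by norm_num)
    refine (h.const_mul (-(√(2 * Real.pi * ((1 : NNReal) : ℝ)))⁻¹)).congr
      (Filter.Eventually.of_forall fun t => ?_)
    rw [gaussianPDFReal_def]
    simp only
    rw [show -(1 / 2 : ℝ) * t ^ 2 = -(t - 0) ^ 2 / (2 * ((1 : NNReal) : ℝ)) by simp; ring]
    ring
  have h1 := integral_mul_deriv_eq_deriv_mul_of_integrable (u := f) (u' := f')
    (v := fun t => ((gaussianPDFReal 0 1 t : ℝ) : ℂ))
    (v' := fun t => ((-t * gaussianPDFReal 0 1 t : ℝ) : ℂ))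
    (fun t _ => hf t) (fun t _ => (hasDerivAt_gaussianPDFReal t).ofReal_comp)
    (hp'.bdd_mul hfc.aestronglyMeasurable (Filter.Eventually.of_forall hC))
    (hp.bdd_mul hf'.aestronglyMeasurable (Filter.Eventually.of_forall hC'))
    (hp.bdd_mul hfc.aestronglyMeasurable (Filter.Eventually.of_forall hC))
  rw [integral_gaussianReal_eq_integral_smul one_ne_zero,
    integral_gaussianReal_eq_integral_smul one_ne_zero, ← neg_inj]
  calc _ = ∫ t, f t * ((-t * gaussianPDFReal 0 1 t : ℝ) : ℂ) := by
        rw [← integral_neg]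
        refine integral_congr_ae (Filter.Eventually.of_forall fun t => ?_)
        simp only [Complex.real_smul]
        push_cast
        ring
    _ = _ := by
        rw [h1]
        congr 1
        refine integral_congr_ae (Filter.Eventually.of_forall fun t => ?_)
        simp only [Complex.real_smul]
        ring

variable {ι : Type*} [Fintype ι]

/-- The standard Gaussian measure on `ι → ℝ`. -/
noncomputable def stdGauss (ι : Type*) [Fintype ι] : Measure (ι → ℝ) :=
  Measure.pi fun _ => gaussianReal 0 1

instance : IsProbabilityMeasure (stdGauss ι) := by
  unfold stdGauss; infer_instance

instance : IsGaussian (stdGauss ι) := by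
  have h := iIndepFun.hasGaussianLaw (P := stdGauss ι) (X := fun i (x : ι → ℝ) => x i)
    (fun i => by
      have : HasLaw (fun x : ι → ℝ => x i) (gaussianReal 0 1) (stdGauss ι) :=
        ⟨(measurable_pi_apply i).aemeasurable,
          (measurePreserving_eval (fun _ : ι => gaussianReal 0 1) i).map_eq⟩
      exact this.hasGaussianLaw)
    (iIndepFun_pi (X := fun _ t => t) fun i => aemeasurable_id)
  have h2 := h.isGaussian_map
  rwa [show (fun (x : ι → ℝ) i => x i) = id from rfl, Measure.map_id] at h2

theorem integrable_eval_stdGauss (k : ι) : Integrable (fun x : ι → ℝ => x k) (stdGauss ι) :=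
  (measurePreserving_eval (fun _ : ι => gaussianReal 0 1) k).integrable_comp_of_integrable
    integrable_gaussianReal_id

/-- Replacing one coordinate by an independent standard Gaussian variable preserves the law. -/
theorem map_update_stdGauss [DecidableEq ι] (k : ι) :
    ((stdGauss ι).prod (gaussianReal 0 1)).map (fun p => Function.update p.1 k p.2)
      = stdGauss ι := by
  have hm : Measurable fun p : (ι → ℝ) × ℝ => Function.update p.1 k p.2 := by fun_prop
  refine (Measure.pi_eq fun s hs => ?_).symm
  rw [Measure.map_apply hm (MeasurableSet.univ_pi hs)]
  have : (fun p : (ι → ℝ) × ℝ => Function.update p.1 k p.2) ⁻¹' (Set.univ.pi s)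
      = (Set.univ.pi (Function.update s k Set.univ)) ×ˢ s k := by
    ext ⟨x, t⟩
    simp only [Set.mem_preimage, Set.mem_univ_pi, Set.mem_prod]
    constructor
    · intro h
      refine ⟨fun i => ?_, by simpa using h k⟩
      by_cases hi : i = k
      · subst hi; simp
      · simpa [hi] using h i
    · rintro ⟨h, h'⟩ i
      by_cases hi : i = k
      · subst hi; simpa using h'
      · simpa [hi] using h i
  rw [this, Measure.prod_prod, stdGauss, Measure.pi_pi]
  rw [← Finset.mul_prod_erase _ _ (Finset.mem_univ k),
    ← Finset.mul_prod_erase Finset.univ (fun i => gaussianReal 0 1 (s i)) (Finset.mem_univ k)]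
  simp only [Function.update_self, measure_univ, one_mul]
  rw [mul_comm]
  congr 1
  refine Finset.prod_congr rfl fun i hi => ?_
  rw [Function.update_of_ne (Finset.ne_of_mem_erase hi)]

/-- The real-linear form on `ι → ℝ` with the given complex partial derivatives. -/
noncomputable def gradForm (v : ι → ℂ) : (ι → ℝ) →L[ℝ] ℂ :=
  ∑ k, (ContinuousLinearMap.proj k : (ι → ℝ) →L[ℝ] ℝ).smulRight (v k)

theorem gradForm_apply (v : ι → ℂ) (x : ι → ℝ) : gradForm v x = ∑ k, (x k : ℂ) * v k := by
  simp [gradForm]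

/-- `F` is a bounded function on `ι → ℝ` with bounded continuous partial derivatives `F' · k`. The
derivatives are carried along explicitly, so that gradient norms can be computed. -/
structure HasBddGrad (F : (ι → ℝ) → ℂ) (F' : (ι → ℝ) → ι → ℂ) : Prop where
  hasFDerivAt : ∀ x, HasFDerivAt F (gradForm (F' x)) x
  continuous_grad : Continuous F'
  bdd : ∃ C, ∀ x, ‖F x‖ ≤ C
  bdd_grad : ∃ C, ∀ x k, ‖F' x k‖ ≤ C

namespace HasBddGrad

variable {F G : (ι → ℝ) → ℂ} {F' G' : (ι → ℝ) → ι → ℂ}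

theorem continuous (hF : HasBddGrad F F') : Continuous F :=
  continuous_iff_continuousAt.mpr fun x => (hF.hasFDerivAt x).continuousAt

theorem integrable (hF : HasBddGrad F F') : Integrable F (stdGauss ι) :=
  let ⟨C, hC⟩ := hF.bdd
  Integrable.of_bound hF.continuous.aestronglyMeasurable C (Filter.Eventually.of_forall hC)

theorem continuous_grad_apply (hF : HasBddGrad F F') (k : ι) : Continuous fun x => F' x k :=
  (continuous_apply k).comp hF.continuous_grad

theorem integrable_grad (hF : HasBddGrad F F') (k : ι) :
    Integrable (fun x => F' x k) (stdGauss ι) :=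
  let ⟨C, hC⟩ := hF.bdd_grad
  Integrable.of_bound (hF.continuous_grad_apply k).aestronglyMeasurable C
    (Filter.Eventually.of_forall fun x => hC x k)

theorem integrable_eval_mul (hF : HasBddGrad F F') (k : ι) :
    Integrable (fun x => (x k : ℂ) * F x) (stdGauss ι) :=
  let ⟨_, hC⟩ := hF.bdd
  (integrable_eval_stdGauss k).ofReal.mul_bdd hF.continuous.aestronglyMeasurable
    (Filter.Eventually.of_forall hC)

theorem const (c : ℂ) : HasBddGrad (fun _ : ι → ℝ => c) 0 where
  hasFDerivAt x := by
    have : gradForm ((0 : (ι → ℝ) → ι → ℂ) x) = 0 := by ext y; simp [gradForm_apply]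
    rw [this]; exact hasFDerivAt_const c x
  continuous_grad := continuous_const
  bdd := ⟨‖c‖, fun _ => le_rfl⟩
  bdd_grad := ⟨0, fun _ _ => by simp⟩

theorem add (hF : HasBddGrad F F') (hG : HasBddGrad G G') :
    HasBddGrad (fun x => F x + G x) (fun x k => F' x k + G' x k) where
  hasFDerivAt x := by
    refine ((hF.hasFDerivAt x).add (hG.hasFDerivAt x)).congr_fderiv ?_
    ext y
    simp [gradForm_apply, mul_add, Finset.sum_add_distrib]
  continuous_grad := hF.continuous_grad.add hG.continuous_grad
  bdd := by
    obtain ⟨C, hC⟩ := hF.bdd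
    obtain ⟨D, hD⟩ := hG.bdd
    exact ⟨C + D, fun x => (norm_add_le _ _).trans (add_le_add (hC x) (hD x))⟩
  bdd_grad := by
    obtain ⟨C, hC⟩ := hF.bdd_grad
    obtain ⟨D, hD⟩ := hG.bdd_grad
    exact ⟨C + D, fun x k => (norm_add_le _ _).trans (add_le_add (hC x k) (hD x k))⟩

theorem mul (hF : HasBddGrad F F') (hG : HasBddGrad G G') :
    HasBddGrad (fun x => F x * G x) (fun x k => F' x k * G x + F x * G' x k) where
  hasFDerivAt x := by
    refine ((hF.hasFDerivAt x).mul (hG.hasFDerivAt x)).congr_fderiv ?_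
    ext y
    simp only [gradForm_apply, FunLike.coe_add, FunLike.coe_smul,
      Pi.add_apply, Pi.smul_apply, smul_eq_mul, Finset.mul_sum, ← Finset.sum_add_distrib]
    exact Finset.sum_congr rfl fun k _ => by ring
  continuous_grad := continuous_pi fun k =>
    ((hF.continuous_grad_apply k).mul hG.continuous).add
      (hF.continuous.mul (hG.continuous_grad_apply k))
  bdd := by
    obtain ⟨C, hC⟩ := hF.bdd
    obtain ⟨D, hD⟩ := hG.bdd
    refine ⟨C * D, fun x => ?_⟩
    rw [norm_mul]
    exact mul_le_mul (hC x) (hD x) (norm_nonneg _) ((norm_nonneg _).trans (hC x))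
  bdd_grad := by
    obtain ⟨C, hC⟩ := hF.bdd
    obtain ⟨D, hD⟩ := hG.bdd
    obtain ⟨C', hC'⟩ := hF.bdd_grad
    obtain ⟨D', hD'⟩ := hG.bdd_grad
    refine ⟨C' * D + C * D', fun x k => (norm_add_le _ _).trans (add_le_add ?_ ?_)⟩
    · rw [norm_mul]
      exact mul_le_mul (hC' x k) (hD x) (norm_nonneg _) ((norm_nonneg _).trans (hC' x k))
    · rw [norm_mul]
      exact mul_le_mul (hC x) (hD' x k) (norm_nonneg _) ((norm_nonneg _).trans (hC x))

theorem const_mul (c : ℂ) (hF : HasBddGrad F F') :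
    HasBddGrad (fun x => c * F x) (fun x k => c * F' x k) := by
  have := (HasBddGrad.const c).mul hF
  simpa using this

theorem sum {κ : Type*} (s : Finset κ) {F : κ → (ι → ℝ) → ℂ} {F' : κ → (ι → ℝ) → ι → ℂ}
    (hF : ∀ j ∈ s, HasBddGrad (F j) (F' j)) :
    HasBddGrad (fun x => ∑ j ∈ s, F j x) (fun x k => ∑ j ∈ s, F' j x k) := by
  classical
  induction s using Finset.induction_on with
  | empty => simpa using! HasBddGrad.const (ι := ι) 0
  | insert a s ha ih =>
    simp only [Finset.sum_insert ha]
    exact (hF a (Finset.mem_insert_self a s)).add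
      (ih fun j hj => hF j (Finset.mem_insert_of_mem hj))

theorem conj (hF : HasBddGrad F F') :
    HasBddGrad (fun x => star (F x)) (fun x k => star (F' x k)) where
  hasFDerivAt x := by
    refine ((Complex.conjCLE.toContinuousLinearMap.hasFDerivAt (x := F x)).comp x
      (hF.hasFDerivAt x)).congr_fderiv ?_
    ext y
    simp [gradForm_apply]
  continuous_grad := continuous_pi fun k => (hF.continuous_grad_apply k).star
  bdd := by simpa using hF.bdd
  bdd_grad := by simpa using hF.bdd_grad

theorem exp (hF : HasBddGrad F F') :
    HasBddGrad (fun x => Complex.exp (F x)) (fun x k => Complex.exp (F x) * F' x k) where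
  hasFDerivAt x := by
    refine ((hF.hasFDerivAt x).cexp).congr_fderiv ?_
    ext y
    simp only [gradForm_apply, FunLike.coe_smul, Pi.smul_apply, smul_eq_mul,
      Finset.mul_sum]
    exact Finset.sum_congr rfl fun k _ => by ring
  continuous_grad := continuous_pi fun k =>
    (Complex.continuous_exp.comp hF.continuous).mul (hF.continuous_grad_apply k)
  bdd := by
    obtain ⟨C, hC⟩ := hF.bdd
    refine ⟨Real.exp C, fun x => ?_⟩
    rw [Complex.norm_exp]
    exact Real.exp_le_exp.mpr ((Complex.re_le_norm _).trans (hC x))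
  bdd_grad := by
    obtain ⟨C, hC⟩ := hF.bdd
    obtain ⟨D, hD⟩ := hF.bdd_grad
    refine ⟨Real.exp C * D, fun x k => ?_⟩
    rw [norm_mul, Complex.norm_exp]
    exact mul_le_mul (Real.exp_le_exp.mpr ((Complex.re_le_norm _).trans (hC x))) (hD x k)
      (norm_nonneg _) (Real.exp_nonneg _)

theorem comp_affine (hF : HasBddGrad F F') (a : ι → ℝ) (c : ℝ) :
    HasBddGrad (fun x => F (a + c • x)) (fun x k => c * F' (a + c • x) k) where
  hasFDerivAt x := by
    have h : HasFDerivAt (fun x : ι → ℝ => a + c • x) (c • ContinuousLinearMap.id ℝ (ι → ℝ)) x :=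
      ((hasFDerivAt_id x).const_smul c).const_add a
    refine ((hF.hasFDerivAt (a + c • x)).comp x h).congr_fderiv ?_
    ext y
    simp only [gradForm_apply, ContinuousLinearMap.comp_apply, FunLike.coe_smul,
      Pi.smul_apply, smul_eq_mul, ContinuousLinearMap.id_apply]
    exact Finset.sum_congr rfl fun k _ => by push_cast; ring
  continuous_grad := continuous_pi fun k =>
    continuous_const.mul ((hF.continuous_grad_apply k).comp (by fun_prop))
  bdd := let ⟨C, hC⟩ := hF.bdd; ⟨C, fun x => hC _⟩
  bdd_grad := by
    obtain ⟨C, hC⟩ := hF.bdd_grad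
    refine ⟨|c| * C, fun x k => ?_⟩
    rw [norm_mul, Complex.norm_real]
    exact mul_le_mul_of_nonneg_left (hC _ _) (abs_nonneg _)

/-- Gaussian integration by parts. -/
theorem integral_eval_mul (hF : HasBddGrad F F') (k : ι) :
    ∫ x, (x k : ℂ) * F x ∂stdGauss ι = ∫ x, F' x k ∂stdGauss ι := by
  classical
  obtain ⟨C, hC⟩ := hF.bdd
  obtain ⟨C', hC'⟩ := hF.bdd_grad
  have hm : Measurable fun p : (ι → ℝ) × ℝ => Function.update p.1 k p.2 := by fun_prop
  have hmp : MeasurePreserving (fun p : (ι → ℝ) × ℝ => Function.update p.1 k p.2)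
      ((stdGauss ι).prod (gaussianReal 0 1)) (stdGauss ι) := ⟨hm, map_update_stdGauss k⟩
  have key : ∀ {f : (ι → ℝ) → ℂ}, Integrable f (stdGauss ι) → ∫ x, f x ∂stdGauss ι
      = ∫ x, ∫ t, f (Function.update x k t) ∂gaussianReal 0 1 ∂stdGauss ι := by
    intro f hf
    rw [← integral_prod (fun p : (ι → ℝ) × ℝ => f (Function.update p.1 k p.2))
      (hmp.integrable_comp_of_integrable hf)]
    conv_lhs => rw [← map_update_stdGauss k]
    rw [integral_map hm.aemeasurable]
    rw [map_update_stdGauss]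
    exact hf.aestronglyMeasurable
  rw [key (hF.integrable_eval_mul k), key (hF.integrable_grad k)]
  refine integral_congr_ae (Filter.Eventually.of_forall fun x => ?_)
  simp only [Function.update_self]
  refine integral_id_mul_gaussianReal (f := fun t => F (Function.update x k t)) (C := max C C')
    (fun t => ?_) ?_ (fun t => (hC _).trans (le_max_left _ _))
    (fun t => (hC' _ _).trans (le_max_right _ _))
  · have h := (hF.hasFDerivAt (Function.update x k t)).comp_hasDerivAt t (hasDerivAt_update x k t)
    refine h.congr_deriv ?_
    rw [gradForm_apply, Finset.sum_eq_single k] <;> simp +contextual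
  · exact (hF.continuous_grad_apply k).comp (continuous_const.update k continuous_id)

end HasBddGrad

end GaussianIntegrationByParts

/-! ### The Gaussian covariance inequality -/

section GaussianCovariance

variable {ι : Type*} [Fintype ι] {F G : (ι → ℝ) → ℂ} {F' G' : (ι → ℝ) → ι → ℂ}

/-- A pair of independent standard Gaussian vectors is invariant in law under rotations. -/
theorem measurePreserving_rotation (θ : ℝ) :
    MeasurePreserving (fun p : (ι → ℝ) × (ι → ℝ) =>
        (Real.cos θ • p.1 + Real.sin θ • p.2, -Real.sin θ • p.1 + Real.cos θ • p.2))
      ((stdGauss ι).prod (stdGauss ι)) ((stdGauss ι).prod (stdGauss ι)) := by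
  have h := IsGaussian.map_rotation_eq_self_of_forall_strongDual_eq_zero (μ := stdGauss ι)
    (fun L => ?_) θ
  · exact ⟨by fun_prop, h⟩
  · have hL : ∀ x : ι → ℝ, L x = ∑ k, x k * L (Pi.basisFun ℝ ι k) := fun x => by
      conv_lhs => rw [← (Pi.basisFun ℝ ι).sum_repr x]
      simp
    rw [integral_congr_ae (Filter.Eventually.of_forall hL)]
    rw [integral_finsetSum _ fun k _ => (integrable_eval_stdGauss k).mul_const _]
    refine Finset.sum_eq_zero fun k _ => ?_
    rw [integral_mul_const]
    have h0 : ∫ x : ι → ℝ, x k ∂stdGauss ι = 0 := by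
      have := (measurePreserving_eval (fun _ : ι => gaussianReal 0 1) k)
      rw [stdGauss, ← integral_map (φ := fun x : ι → ℝ => x k) (f := fun t => t)
        this.measurable.aemeasurable (by fun_prop), this.map_eq]
      exact integral_id_gaussianReal
    rw [h0, zero_mul]

theorem hasDerivAt_integral_rotation (hF : HasBddGrad F F') (hG : HasBddGrad G G') (θ : ℝ) :
    HasDerivAt (fun θ : ℝ => ∫ p : (ι → ℝ) × (ι → ℝ),
        F p.1 * G (Real.cos θ • p.1 + Real.sin θ • p.2) ∂(stdGauss ι).prod (stdGauss ι))
      (∫ p : (ι → ℝ) × (ι → ℝ), F p.1 * gradForm (G' (Real.cos θ • p.1 + Real.sin θ • p.2))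
        (-Real.sin θ • p.1 + Real.cos θ • p.2) ∂(stdGauss ι).prod (stdGauss ι)) θ := by
  have hFc := hF.continuous
  have hGc := hG.continuous
  obtain ⟨C, hC⟩ := hF.bdd
  obtain ⟨D, hD⟩ := hG.bdd
  obtain ⟨D', hD'⟩ := hG.bdd_grad
  have hC0 : 0 ≤ C := (norm_nonneg _).trans (hC 0)
  have hcomp1 : ∀ k, Integrable (fun p : (ι → ℝ) × (ι → ℝ) => p.1 k)
      ((stdGauss ι).prod (stdGauss ι)) := fun k =>
    measurePreserving_fst.integrable_comp_of_integrable (integrable_eval_stdGauss k)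
  have hcomp2 : ∀ k, Integrable (fun p : (ι → ℝ) × (ι → ℝ) => p.2 k)
      ((stdGauss ι).prod (stdGauss ι)) := fun k =>
    measurePreserving_snd.integrable_comp_of_integrable (integrable_eval_stdGauss k)
  refine (hasDerivAt_integral_of_dominated_loc_of_deriv_le (s := Set.univ)
    (bound := fun p : (ι → ℝ) × (ι → ℝ) => C * ∑ k, (|p.1 k| + |p.2 k|) * D')
    (F := fun (θ : ℝ) (p : (ι → ℝ) × (ι → ℝ)) =>
      F p.1 * G (Real.cos θ • p.1 + Real.sin θ • p.2))
    (F' := fun (θ : ℝ) (p : (ι → ℝ) × (ι → ℝ)) =>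
      F p.1 * gradForm (G' (Real.cos θ • p.1 + Real.sin θ • p.2))
        (-Real.sin θ • p.1 + Real.cos θ • p.2)) Filter.univ_mem ?_ ?_ ?_ ?_ ?_ ?_).2
  · refine Filter.Eventually.of_forall fun θ => Continuous.aestronglyMeasurable ?_
    fun_prop
  · refine Integrable.of_bound (Continuous.aestronglyMeasurable (by fun_prop)) (C * D)
      (Filter.Eventually.of_forall fun p => ?_)
    rw [norm_mul]
    exact mul_le_mul (hC _) (hD _) (norm_nonneg _) hC0
  · refine Continuous.aestronglyMeasurable ?_
    simp only [gradForm_apply]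
    have := hG.continuous_grad_apply
    fun_prop
  · refine Filter.Eventually.of_forall fun p θ _ => ?_
    rw [norm_mul, gradForm_apply]
    refine mul_le_mul (hC _) ((norm_sum_le _ _).trans (Finset.sum_le_sum fun k _ => ?_))
      (norm_nonneg _) hC0
    rw [norm_mul, Complex.norm_real]
    refine mul_le_mul ?_ (hD' _ _) (norm_nonneg _) (by positivity)
    simp only [Pi.add_apply, Pi.smul_apply, smul_eq_mul, Real.norm_eq_abs]
    refine (abs_add_le _ _).trans (add_le_add ?_ ?_)
    · rw [abs_mul, abs_neg]
      exact mul_le_of_le_one_left (abs_nonneg _) (Real.abs_sin_le_one θ)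
    · rw [abs_mul]
      exact mul_le_of_le_one_left (abs_nonneg _) (Real.abs_cos_le_one θ)
  · exact (integrable_finsetSum _ fun k _ =>
      (((hcomp1 k).abs).add ((hcomp2 k).abs)).mul_const D').const_mul C
  · refine Filter.Eventually.of_forall fun p θ _ => ?_
    have h : HasDerivAt (fun θ : ℝ => Real.cos θ • p.1 + Real.sin θ • p.2)
        (-Real.sin θ • p.1 + Real.cos θ • p.2) θ :=
      ((Real.hasDerivAt_cos θ).smul_const p.1).add ((Real.hasDerivAt_sin θ).smul_const p.2)
    exact ((hG.hasFDerivAt _).comp_hasDerivAt θ h).const_mul (F p.1)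

theorem norm_integral_rotation_deriv_le (hF : HasBddGrad F F') (hG : HasBddGrad G G')
    {h : (ι → ℝ) → ℝ} (hh : Integrable h (stdGauss ι))
    (hle : ∀ x y, ‖∑ k, F' x k * G' y k‖ ≤ h y) (θ : ℝ) :
    ‖∫ p : (ι → ℝ) × (ι → ℝ), F p.1 * gradForm (G' (Real.cos θ • p.1 + Real.sin θ • p.2))
        (-Real.sin θ • p.1 + Real.cos θ • p.2) ∂(stdGauss ι).prod (stdGauss ι)‖
      ≤ |Real.sin θ| * ∫ x, h x ∂stdGauss ι := by
  have hFc := hF.continuous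
  have hG'c := hG.continuous_grad_apply
  obtain ⟨C, hC⟩ := hF.bdd
  obtain ⟨D', hD'⟩ := hG.bdd_grad
  have hC0 : 0 ≤ C := (norm_nonneg _).trans (hC 0)
  set s := Real.sin θ
  set c := Real.cos θ
  -- In the rotated coordinates `u = c x + s y`, `v = -s x + c y` one has `x = c u - s v`.
  set g : (ι → ℝ) × (ι → ℝ) → ℂ := fun q => F (c • q.1 + (-s) • q.2) * gradForm (G' q.1) q.2
    with hg
  have hgc : Continuous g := by
    simp only [hg, gradForm_apply]
    fun_prop
  have hrot : ∫ p : (ι → ℝ) × (ι → ℝ), F p.1 * gradForm (G' (c • p.1 + s • p.2))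
        (-s • p.1 + c • p.2) ∂(stdGauss ι).prod (stdGauss ι)
      = ∫ q, g q ∂(stdGauss ι).prod (stdGauss ι) := by
    have hmp := measurePreserving_rotation (ι := ι) θ
    conv_rhs => rw [← hmp.map_eq]
    rw [integral_map hmp.measurable.aemeasurable hgc.aestronglyMeasurable]
    refine integral_congr_ae (Filter.Eventually.of_forall fun p => ?_)
    simp only [hg]
    congr 2
    ext k
    simp only [Pi.add_apply, Pi.smul_apply, smul_eq_mul]
    have := Real.cos_sq_add_sin_sq θ
    linear_combination (-p.1 k) * this
  have hgi : Integrable g ((stdGauss ι).prod (stdGauss ι)) := by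
    have hb : Integrable (fun q : (ι → ℝ) × (ι → ℝ) => C * ∑ k, |q.2 k| * D')
        ((stdGauss ι).prod (stdGauss ι)) :=
      (integrable_finsetSum _ fun k _ => ((measurePreserving_snd.integrable_comp_of_integrable
        (integrable_eval_stdGauss k)).abs).mul_const D').const_mul C
    refine hb.mono' hgc.aestronglyMeasurable (Filter.Eventually.of_forall fun q => ?_)
    rw [hg, norm_mul, gradForm_apply]
    refine mul_le_mul (hC _) ((norm_sum_le _ _).trans (Finset.sum_le_sum fun k _ => ?_))
      (norm_nonneg _) hC0
    rw [norm_mul, Complex.norm_real]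
    exact mul_le_mul_of_nonneg_left (hD' _ _) (abs_nonneg _)
  rw [hrot, integral_prod _ hgi, ← integral_const_mul]
  refine norm_integral_le_of_norm_le (hh.const_mul _) (Filter.Eventually.of_forall fun u => ?_)
  have hFu := hF.comp_affine (c • u) (-s)
  have hinner : ∫ v, g (u, v) ∂stdGauss ι
      = ∫ v, (-s : ℝ) * ∑ k, F' (c • u + (-s) • v) k * G' u k ∂stdGauss ι := by
    calc ∫ v, g (u, v) ∂stdGauss ι
        = ∫ v, ∑ k, ((v k : ℂ) * F (c • u + (-s) • v)) * G' u k ∂stdGauss ι := by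
          refine integral_congr_ae (Filter.Eventually.of_forall fun v => ?_)
          simp only [hg, gradForm_apply, Finset.mul_sum]
          exact Finset.sum_congr rfl fun k _ => by ring
      _ = ∑ k, (∫ v, ((-s : ℝ) : ℂ) * F' (c • u + (-s) • v) k ∂stdGauss ι) * G' u k := by
          rw [integral_finsetSum _ fun k _ => (hFu.integrable_eval_mul k).mul_const _]
          refine Finset.sum_congr rfl fun k _ => ?_
          rw [integral_mul_const, hFu.integral_eval_mul k]
      _ = _ := by
          simp only [← integral_mul_const]
          rw [← integral_finsetSum _ fun k _ => (hFu.integrable_grad k).mul_const _]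
          refine integral_congr_ae (Filter.Eventually.of_forall fun v => ?_)
          simp only [Finset.mul_sum, mul_assoc]
  rw [hinner]
  refine (norm_integral_le_of_norm_le_const (C := |s| * h u)
    (Filter.Eventually.of_forall fun v => ?_)).trans_eq (by simp)
  rw [norm_mul, Complex.norm_real, norm_neg, Real.norm_eq_abs]
  exact mul_le_mul_of_nonneg_left (hle _ _) (abs_nonneg _)

/-- A Gaussian covariance inequality: if `‖⟨∇F(x), ∇G(y)⟩‖ ≤ h(y)` for all `x` and `y`, then
`‖Cov(F, G)‖ ≤ E h`. Interpolate between `E[F G]` and `E F * E G` by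
`Ψ(θ) = E[F(X) G(cos θ X + sin θ Y)]`, where `X` and `Y` are independent. Rotation invariance and
integration by parts give `‖Ψ'(θ)‖ ≤ |sin θ| E h`, and `sin` has integral `1` over `[0, π/2]`. -/
theorem norm_covariance_le (hF : HasBddGrad F F') (hG : HasBddGrad G G')
    {h : (ι → ℝ) → ℝ} (hh : Integrable h (stdGauss ι))
    (hle : ∀ x y, ‖∑ k, F' x k * G' y k‖ ≤ h y) :
    ‖∫ x, F x * G x ∂stdGauss ι - (∫ x, F x ∂stdGauss ι) * ∫ x, G x ∂stdGauss ι‖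
      ≤ ∫ x, h x ∂stdGauss ι := by
  set Ψ : ℝ → ℂ := fun θ => ∫ p : (ι → ℝ) × (ι → ℝ),
    F p.1 * G (Real.cos θ • p.1 + Real.sin θ • p.2) ∂(stdGauss ι).prod (stdGauss ι) with hΨ
  have hder := hasDerivAt_integral_rotation hF hG
  have h0 : Ψ 0 = ∫ x, F x * G x ∂stdGauss ι := by
    simp only [hΨ, Real.cos_zero, Real.sin_zero, one_smul, zero_smul, add_zero]
    rw [integral_fun_fst (μ := stdGauss ι) (ν := stdGauss ι) (fun x => F x * G x)]
    simp
  have h1 : Ψ (Real.pi / 2) = (∫ x, F x ∂stdGauss ι) * ∫ x, G x ∂stdGauss ι := by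
    simp only [hΨ, Real.cos_pi_div_two, Real.sin_pi_div_two, one_smul, zero_smul, zero_add]
    exact integral_prod_mul F G
  set H := ∫ x, h x ∂stdGauss ι
  have hH : 0 ≤ H := integral_nonneg fun x => (norm_nonneg _).trans (hle x x)
  have hbound : ∀ ⦃θ⦄, θ ∈ Set.Icc (0 : ℝ) (Real.pi / 2) →
      ‖Ψ θ - Ψ 0‖ ≤ H * (1 - Real.cos θ) := by
    refine image_norm_le_of_norm_deriv_right_le_deriv_boundary
      (f := fun θ => Ψ θ - Ψ 0) (B := fun θ => H * (1 - Real.cos θ))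
      (B' := fun θ => H * Real.sin θ)
      (fun θ _ => ((hder θ).continuousAt.sub continuousAt_const).continuousWithinAt)
      (fun θ _ => ((hder θ).sub_const _).hasDerivWithinAt) (by simp)
      (fun θ => ?_) (fun θ hθ => ?_)
    · have := (((Real.hasDerivAt_cos θ).const_sub 1).const_mul H)
      simpa using this
    · refine (norm_integral_rotation_deriv_le hF hG hh hle θ).trans_eq ?_
      rw [abs_of_nonneg (Real.sin_nonneg_of_nonneg_of_le_pi hθ.1
        (by linarith [hθ.2, Real.pi_pos])), mul_comm]
  have h2 := hbound (Set.right_mem_Icc.mpr (by positivity))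
  rw [norm_sub_rev, h0, h1] at h2
  simpa using h2

end GaussianCovariance

/-! ### Poincaré inequality and concentration -/

section GaussianConcentration

variable {ι : Type*} [Fintype ι] {W : (ι → ℝ) → ℂ} {W' : (ι → ℝ) → ι → ℂ} {V : ℝ}

theorem norm_sum_mul_le_sqrt {κ : Type*} (s : Finset κ) (f g : κ → ℂ) :
    ‖∑ k ∈ s, f k * g k‖ ≤ √(∑ k ∈ s, ‖f k‖ ^ 2) * √(∑ k ∈ s, ‖g k‖ ^ 2) := by
  refine (norm_sum_le _ _).trans ?_
  simp only [norm_mul]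
  exact Real.sum_mul_le_sqrt_mul_sqrt s _ _

/-- The covariance inequality applied to `W̄` and `W exp(a ‖W‖²)`. The hypothesis bounds the sum over
`k` of the squared moduli of the complex derivatives, that is, the sum of the squared gradient norms
of the real and the imaginary part; this is what avoids a loss compared with a real-valued `W`. -/
theorem integral_norm_sq_mul_exp_le (hW : HasBddGrad W W') (hW0 : ∫ x, W x ∂stdGauss ι = 0)
    (hV : ∀ x, ∑ k, ‖W' x k‖ ^ 2 ≤ V) {a : ℝ} (ha : 0 ≤ a) :
    ∫ x, ‖W x‖ ^ 2 * Real.exp (a * ‖W x‖ ^ 2) ∂stdGauss ι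
      ≤ V * ∫ x, (1 + 2 * a * ‖W x‖ ^ 2) * Real.exp (a * ‖W x‖ ^ 2) ∂stdGauss ι := by
  have hWc := hW.continuous
  obtain ⟨C, hC⟩ := hW.bdd
  have hV0 : 0 ≤ V := (Finset.sum_nonneg fun k _ => sq_nonneg _).trans (hV 0)
  have hG := hW.mul ((hW.mul hW.conj).const_mul (a : ℂ)).exp
  have hexp : ∀ x, Complex.exp (a * (W x * star (W x))) = (Real.exp (a * ‖W x‖ ^ 2) : ℝ) := by
    intro x
    rw [RCLike.star_def, Complex.mul_conj']
    push_cast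
    rfl
  have hint : Integrable (fun x => (1 + 2 * a * ‖W x‖ ^ 2) * Real.exp (a * ‖W x‖ ^ 2))
      (stdGauss ι) := by
    refine Integrable.of_bound (Continuous.aestronglyMeasurable (by fun_prop))
      ((1 + 2 * a * C ^ 2) * Real.exp (a * C ^ 2)) (Filter.Eventually.of_forall fun x => ?_)
    rw [Real.norm_eq_abs, abs_of_nonneg (by positivity)]
    have := pow_le_pow_left₀ (norm_nonneg _) (hC x) 2
    gcongr
  have h := norm_covariance_le hW.conj hG
    (h := fun x => V * ((1 + 2 * a * ‖W x‖ ^ 2) * Real.exp (a * ‖W x‖ ^ 2)))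
    (hint.const_mul V) (fun x y => ?_)
  · have h1 : ∫ x, star (W x) ∂stdGauss ι = 0 := by
      have : ∫ x, star (W x) ∂stdGauss ι = star (∫ x, W x ∂stdGauss ι) := integral_conj
      rw [this, hW0, star_zero]
    have h2 : ∫ x, star (W x) * (W x * Complex.exp (a * (W x * star (W x)))) ∂stdGauss ι
        = ((∫ x, ‖W x‖ ^ 2 * Real.exp (a * ‖W x‖ ^ 2) ∂stdGauss ι : ℝ) : ℂ) := by
      rw [← integral_complex_ofReal]
      refine integral_congr_ae (Filter.Eventually.of_forall fun x => ?_)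
      simp only [hexp]
      rw [← mul_assoc, RCLike.star_def, Complex.conj_mul']
      push_cast
      rfl
    rw [h1, zero_mul, sub_zero, h2, integral_const_mul, Complex.norm_real] at h
    exact (le_abs_self _).trans h
  · refine (norm_sum_mul_le_sqrt _ _ _).trans ?_
    have hb : 0 ≤ (1 + 2 * a * ‖W y‖ ^ 2) * Real.exp (a * ‖W y‖ ^ 2) := by positivity
    have h1 : √(∑ k, ‖star (W' x k)‖ ^ 2) ≤ √V := by
      simp only [norm_star]
      exact Real.sqrt_le_sqrt (hV x)
    have h2 : √(∑ k, ‖W' y k * Complex.exp (a * (W y * star (W y)))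
          + W y * (Complex.exp (a * (W y * star (W y)))
            * (a * (W' y k * star (W y) + W y * star (W' y k))))‖ ^ 2)
        ≤ √V * ((1 + 2 * a * ‖W y‖ ^ 2) * Real.exp (a * ‖W y‖ ^ 2)) := by
      rw [← Real.sqrt_sq hb, ← Real.sqrt_mul hV0]
      refine Real.sqrt_le_sqrt ?_
      refine le_trans ?_ (mul_le_mul_of_nonneg_right (hV y) (sq_nonneg _))
      · rw [Finset.sum_mul]
        refine Finset.sum_le_sum fun k _ => ?_
        rw [← mul_pow]
        refine pow_le_pow_left₀ (norm_nonneg _) ?_ 2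
        rw [hexp]
        refine (norm_add_le _ _).trans ?_
        have e1 : ‖((Real.exp (a * ‖W y‖ ^ 2) : ℝ) : ℂ)‖ = Real.exp (a * ‖W y‖ ^ 2) := by
          rw [Complex.norm_real, Real.norm_eq_abs, Real.abs_exp]
        have e2 : ‖(a : ℂ)‖ = a := by rw [Complex.norm_real, Real.norm_eq_abs, abs_of_nonneg ha]
        rw [norm_mul, norm_mul, norm_mul, norm_mul, e1, e2]
        have e3 : ‖W' y k * star (W y) + W y * star (W' y k)‖ ≤ 2 * (‖W y‖ * ‖W' y k‖) := by
          refine (norm_add_le _ _).trans_eq ?_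
          rw [norm_mul, norm_mul, norm_star, norm_star]; ring
        calc _ ≤ ‖W' y k‖ * Real.exp (a * ‖W y‖ ^ 2) + ‖W y‖ * (Real.exp (a * ‖W y‖ ^ 2) *
              (a * (2 * (‖W y‖ * ‖W' y k‖)))) := by gcongr
          _ = _ := by ring
    calc _ ≤ √V * (√V * ((1 + 2 * a * ‖W y‖ ^ 2) * Real.exp (a * ‖W y‖ ^ 2))) :=
          mul_le_mul h1 h2 (Real.sqrt_nonneg _) (Real.sqrt_nonneg _)
      _ = _ := by rw [← mul_assoc, Real.mul_self_sqrt hV0]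

/-- The Gaussian Poincaré inequality, for complex-valued functions. -/
theorem integral_norm_sub_integral_sq_le (hW : HasBddGrad W W')
    (hV : ∀ x, ∑ k, ‖W' x k‖ ^ 2 ≤ V) :
    ∫ x, ‖W x - ∫ y, W y ∂stdGauss ι‖ ^ 2 ∂stdGauss ι ≤ V := by
  have hG := hW.add (HasBddGrad.const (-∫ y, W y ∂stdGauss ι))
  simp only [Pi.zero_apply, add_zero, ← sub_eq_add_neg] at hG
  have h := integral_norm_sq_mul_exp_le hG
    (by rw [integral_sub hW.integrable (integrable_const _)]; simp) hV le_rfl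
  simpa using h

theorem integral_exp_mul_norm_sq_le (hW : HasBddGrad W W') (hW0 : ∫ x, W x ∂stdGauss ι = 0)
    (hV : ∀ x, ∑ k, ‖W' x k‖ ^ 2 ≤ V) {a : ℝ} (ha : 0 ≤ a) :
    (∫ x, Real.exp (a * ‖W x‖ ^ 2) ∂stdGauss ι) ^ 2 * (1 - 2 * a * V) ≤ 1 := by
  have hWc := hW.continuous
  obtain ⟨C, hC⟩ := hW.bdd
  have hb : ∀ t x, Real.exp (t * ‖W x‖ ^ 2) ≤ Real.exp (|t| * C ^ 2) := fun t x => by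
    have := pow_le_pow_left₀ (norm_nonneg _) (hC x) 2
    have := le_abs_self t
    gcongr
  have hint : ∀ t, Integrable (fun x => Real.exp (t * ‖W x‖ ^ 2)) (stdGauss ι) := fun t =>
    Integrable.of_bound (Continuous.aestronglyMeasurable (by fun_prop)) (Real.exp (|t| * C ^ 2))
      (Filter.Eventually.of_forall fun x => by
        rw [Real.norm_eq_abs, Real.abs_exp]; exact hb t x)
  have hint2 : ∀ t, Integrable (fun x => ‖W x‖ ^ 2 * Real.exp (t * ‖W x‖ ^ 2)) (stdGauss ι) :=
    fun t => (hint t).bdd_mul (c := C ^ 2) (Continuous.aestronglyMeasurable (by fun_prop))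
      (Filter.Eventually.of_forall fun x => by
        rw [norm_pow, norm_norm]; exact pow_le_pow_left₀ (norm_nonneg _) (hC x) 2)
  have hset : integrableExpSet (fun x => ‖W x‖ ^ 2) (stdGauss ι) = Set.univ :=
    Set.eq_univ_of_forall hint
  have hder : ∀ t, HasDerivAt (mgf (fun x => ‖W x‖ ^ 2) (stdGauss ι))
      (∫ x, ‖W x‖ ^ 2 * Real.exp (t * ‖W x‖ ^ 2) ∂stdGauss ι) t := fun t =>
    hasDerivAt_mgf (by rw [hset, interior_univ]; trivial)
  have hder2 := fun t => ((hder t).pow 2).mul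
    ((((hasDerivAt_id t).const_mul 2).mul_const V).const_sub 1)
  have hanti : AntitoneOn
      (mgf (fun x => ‖W x‖ ^ 2) (stdGauss ι) ^ 2 * fun t => 1 - 2 * id t * V) (Set.Ici 0) := by
    refine antitoneOn_of_deriv_nonpos (convex_Ici 0)
      (fun t _ => (hder2 t).continuousAt.continuousWithinAt)
      (fun t _ => (hder2 t).differentiableAt.differentiableWithinAt) fun t ht => ?_
    rw [interior_Ici] at ht
    rw [(hder2 t).deriv]
    have h1 := integral_norm_sq_mul_exp_le hW hW0 hV ht.le
    have h2 : ∫ x, (1 + 2 * t * ‖W x‖ ^ 2) * Real.exp (t * ‖W x‖ ^ 2) ∂stdGauss ι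
        = mgf (fun x => ‖W x‖ ^ 2) (stdGauss ι) t
          + 2 * t * ∫ x, ‖W x‖ ^ 2 * Real.exp (t * ‖W x‖ ^ 2) ∂stdGauss ι := by
      rw [mgf, ← integral_const_mul, ← integral_add (hint t) ((hint2 t).const_mul _)]
      exact integral_congr_ae (Filter.Eventually.of_forall fun x => by simp only; ring)
    rw [h2] at h1
    have h3 : 0 ≤ mgf (fun x => ‖W x‖ ^ 2) (stdGauss ι) t := mgf_nonneg
    simp only [Pi.pow_apply, id, Nat.add_one_sub_one, pow_one]
    generalize mgf (fun x => ‖W x‖ ^ 2) (stdGauss ι) t = u at *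
    generalize ∫ x, ‖W x‖ ^ 2 * Real.exp (t * ‖W x‖ ^ 2) ∂stdGauss ι = u' at *
    push_cast
    nlinarith [mul_le_mul_of_nonneg_left h1 h3]
  have h := hanti Set.self_mem_Ici ha ha
  simpa [mgf] using h

theorem exp_le_four_mul {L : ℝ} (h1 : Real.log 2 ≤ L) (h2 : L ≤ 2 * Real.log 2) :
    Real.exp L ≤ 4 * L := by
  have hl := Real.log_two_gt_d9
  rcases le_total L 1 with h | h
  · have := Real.exp_one_lt_d9
    have := Real.exp_le_exp.mpr h
    linarith
  · have h3 : Real.exp L ≤ 4 := by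
      refine (Real.exp_le_exp.mpr h2).trans_eq ?_
      rw [two_mul, Real.exp_add, Real.exp_log two_pos]; norm_num
    linarith

/-- Concentration of a complex function of a Gaussian vector. For `L ≤ 2 log 2` this is Chebyshev's
inequality, and for larger `L` Markov's inequality for `exp(a ‖W‖²)` with `2 a V = 3/4`. -/
theorem measure_norm_sq_ge_le (hW : HasBddGrad W W') (hW0 : ∫ x, W x ∂stdGauss ι = 0)
    (hV0 : 0 < V) (hV : ∀ x, ∑ k, ‖W' x k‖ ^ 2 ≤ V) {L : ℝ} (hL : Real.log 2 ≤ L) :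
    (stdGauss ι).real {x | 4 * V * L ≤ ‖W x‖ ^ 2} ≤ Real.exp (-L) := by
  have hWc := hW.continuous
  obtain ⟨C, hC⟩ := hW.bdd
  have hL0 : 0 < L := (Real.log_pos one_lt_two).trans_le hL
  rcases le_total L (2 * Real.log 2) with h | h
  · have hint : Integrable (fun x => ‖W x‖ ^ 2) (stdGauss ι) :=
      Integrable.of_bound (Continuous.aestronglyMeasurable (by fun_prop)) (C ^ 2)
        (Filter.Eventually.of_forall fun x => by
          rw [norm_pow, norm_norm]; exact pow_le_pow_left₀ (norm_nonneg _) (hC x) 2)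
    have h1 := mul_meas_ge_le_integral_of_nonneg
      (Filter.Eventually.of_forall fun x => sq_nonneg ‖W x‖) hint (4 * V * L)
    have h2 : ∫ x, ‖W x‖ ^ 2 ∂stdGauss ι ≤ V := by
      simpa [hW0] using integral_norm_sub_integral_sq_le hW hV
    have h3 := exp_le_four_mul hL h
    have h4 : 4 * L * (stdGauss ι).real {x | 4 * V * L ≤ ‖W x‖ ^ 2} ≤ 1 := by
      refine le_of_mul_le_mul_left ?_ hV0
      linarith
    rw [Real.exp_neg, ← one_div, le_div_iff₀ (Real.exp_pos _)]
    refine le_trans ?_ h4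
    rw [mul_comm]
    exact mul_le_mul_of_nonneg_right h3 measureReal_nonneg
  · have hint : Integrable (fun x => Real.exp (3 / (8 * V) * ‖W x‖ ^ 2)) (stdGauss ι) :=
      Integrable.of_bound (Continuous.aestronglyMeasurable (by fun_prop))
        (Real.exp (3 / (8 * V) * C ^ 2))
        (Filter.Eventually.of_forall fun x => by
          rw [Real.norm_eq_abs, Real.abs_exp]
          have := pow_le_pow_left₀ (norm_nonneg _) (hC x) 2
          gcongr)
    have h1 := mul_meas_ge_le_integral_of_nonneg
      (Filter.Eventually.of_forall fun x => (Real.exp_pos _).le) hint (Real.exp (3 / 2 * L))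
    have h2 := integral_exp_mul_norm_sq_le hW hW0 hV (a := 3 / (8 * V)) (by positivity)
    have h3 : ∫ x, Real.exp (3 / (8 * V) * ‖W x‖ ^ 2) ∂stdGauss ι ≤ 2 := by
      rw [show 1 - 2 * (3 / (8 * V)) * V = 1 / 4 by field_simp; norm_num] at h2
      nlinarith
    have hset : {x | 4 * V * L ≤ ‖W x‖ ^ 2}
        ⊆ {x | Real.exp (3 / 2 * L) ≤ Real.exp (3 / (8 * V) * ‖W x‖ ^ 2)} := by
      intro x hx
      simp only [Set.mem_ofPred_eq] at hx ⊢
      refine Real.exp_le_exp.mpr ?_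
      calc 3 / 2 * L = 3 / (8 * V) * (4 * V * L) := by field_simp; norm_num
        _ ≤ _ := by gcongr
    have h4 := measureReal_mono (μ := stdGauss ι) hset
    have h5 : 2 ≤ Real.exp (1 / 2 * L) := by
      rw [← Real.log_le_iff_le_exp two_pos]; linarith
    have e : Real.exp (3 / 2 * L) = Real.exp L * Real.exp (1 / 2 * L) := by
      rw [← Real.exp_add]; congr 1; ring
    rw [e] at h1
    rw [Real.exp_neg, ← one_div, le_div_iff₀ (Real.exp_pos _)]
    set p := (stdGauss ι).real {x | 4 * V * L ≤ ‖W x‖ ^ 2}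
    have hp : 0 ≤ p := measureReal_nonneg
    rw [← e] at h1
    have h6 : Real.exp L * Real.exp (1 / 2 * L) * p ≤ 2 := by
      rw [← e]
      exact (mul_le_mul_of_nonneg_left h4 (Real.exp_pos _).le).trans (h1.trans h3)
    nlinarith [mul_le_mul_of_nonneg_left h5 (mul_nonneg hp (Real.exp_pos L).le)]

end GaussianConcentration

/-! ### Resolvents of Gaussian Hermitian matrices -/

section GaussianMatrix

open Matrix

variable {ι n : Type*} [Fintype ι] [Fintype n] [DecidableEq n]

/-- The Hermitian matrix `∑ₖ gₖ Aₖ` with real coefficients `gₖ`. -/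
noncomputable def gaussMatrix (A : ι → Matrix n n ℂ) (g : ι → ℝ) : Matrix n n ℂ :=
  ∑ k, (g k : ℂ) • A k

/-- The resolvent `(z - H)⁻¹` of `H = ∑ₖ gₖ Aₖ + Y` at a diagonal matrix `z`. -/
noncomputable def gaussResolvent (A : ι → Matrix n n ℂ) (Y : Matrix n n ℂ) (z : n → ℂ)
    (g : ι → ℝ) : Matrix n n ℂ :=
  (diagonal z - (gaussMatrix A g + Y))⁻¹

/-- The random matrix `X = ∑ₖ gₖ Aₖ`, with `g` standard Gaussian, is Hermitian and has the covariance
`E[X(a,b) X(c,d)] = σ(a,b) 1[a = d, b = c]` of a complex Hermitian matrix with variance profile `σ`. -/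
structure HasCovariance (A : ι → Matrix n n ℂ) (σ : Matrix n n ℝ) : Prop where
  isHermitian : ∀ k, (A k).IsHermitian
  sum_mul : ∀ a b c d, ∑ k, A k a b * A k c d = if a = d ∧ b = c then (σ a b : ℂ) else 0

variable {A : ι → Matrix n n ℂ} {Y : Matrix n n ℂ} {σ : Matrix n n ℝ} {z : n → ℂ} {η s : ℝ}

omit [Fintype n] in
theorem HasCovariance.isHermitian_add (hA : HasCovariance A σ) (hY : Y.IsHermitian) (g : ι → ℝ) :
    (gaussMatrix A g + Y).IsHermitian := by
  refine IsHermitian.add ?_ hY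
  rw [IsHermitian, gaussMatrix, conjTranspose_sum]
  refine Finset.sum_congr rfl fun k _ => ?_
  rw [conjTranspose_smul, (hA.isHermitian k).eq]
  simp

section Derivative

attribute [local instance] Matrix.linftyOpNormedRing Matrix.linftyOpNormedAlgebra

theorem hasFDerivAt_gaussResolvent_apply (hA : HasCovariance A σ) (hY : Y.IsHermitian)
    (hz : ∀ i, 0 < (z i).im) (i j : n) (g : ι → ℝ) :
    HasFDerivAt (fun g => gaussResolvent A Y z g i j)
      (gradForm fun k => (gaussResolvent A Y z g * A k * gaussResolvent A Y z g) i j) g := by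
  have hu : IsUnit (diagonal z - (gaussMatrix A g + Y)) :=
    (isUnit_iff_isUnit_det _).mpr (isUnit_det_diagonal_sub (hA.isHermitian_add hY g) hz)
  obtain ⟨u, hu⟩ := hu
  have h1 : HasFDerivAt (fun g => diagonal z - (gaussMatrix A g + Y))
      (-∑ k, (ContinuousLinearMap.proj k : (ι → ℝ) →L[ℝ] ℝ).smulRight (A k)) g := by
    have h : HasFDerivAt (gaussMatrix A)
        (∑ k, (ContinuousLinearMap.proj k : (ι → ℝ) →L[ℝ] ℝ).smulRight (A k)) g := by
      have := (∑ k, (ContinuousLinearMap.proj k : (ι → ℝ) →L[ℝ] ℝ).smulRight (A k)).hasFDerivAt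
        (x := g)
      refine this.congr_of_eventuallyEq (Filter.Eventually.of_forall fun g => ?_)
      simp [gaussMatrix]
    exact (h.add_const Y).const_sub _
  have hinv : HasFDerivAt Ring.inverse (-ContinuousLinearMap.mulLeftRight ℝ (Matrix n n ℂ) ↑u⁻¹ ↑u⁻¹)
      (diagonal z - (gaussMatrix A g + Y)) := by
    rw [← hu]; exact hasFDerivAt_ringInverse u
  have h3 := ((entryLinearMap ℝ ℂ i j).toContinuousLinearMap.hasFDerivAt).comp g (hinv.comp g h1)
  have hfun : (fun g => gaussResolvent A Y z g i j) = ⇑(entryLinearMap ℝ ℂ i j).toContinuousLinearMap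
      ∘ Ring.inverse ∘ fun g => diagonal z - (gaussMatrix A g + Y) := by
    funext g
    simp [gaussResolvent, nonsing_inv_eq_ringInverse]
  rw [hfun]
  have hR : (↑u⁻¹ : Matrix n n ℂ) = gaussResolvent A Y z g := by
    rw [gaussResolvent, ← hu, coe_units_inv]
  refine h3.congr_fderiv ?_
  ext v
  have hv : (∑ k, (ContinuousLinearMap.proj k : (ι → ℝ) →L[ℝ] ℝ).smulRight (A k)) v
      = ∑ k, (v k : ℂ) • A k := by simp
  change (-((u⁻¹).1 * (-(∑ k, (ContinuousLinearMap.proj k : (ι → ℝ) →L[ℝ] ℝ).smulRight (A k)) v)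
    * (u⁻¹).1)) i j = _
  rw [hv, hR, gradForm_apply]
  simp [Matrix.mul_sum, Matrix.sum_mul, Matrix.sum_apply]

end Derivative

theorem norm_gaussResolvent_apply_le (hA : HasCovariance A σ) (hY : Y.IsHermitian)
    (hη : 0 < η) (hz : ∀ i, η ≤ (z i).im) (i j : n) (g : ι → ℝ) :
    ‖gaussResolvent A Y z g i j‖ ≤ 1 / η :=
  norm_inv_apply_le (hA.isHermitian_add hY g) hη hz i j

theorem hasBddGrad_gaussResolvent (hA : HasCovariance A σ) (hY : Y.IsHermitian)
    (hη : 0 < η) (hz : ∀ i, η ≤ (z i).im) (i j : n) :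
    HasBddGrad (fun g => gaussResolvent A Y z g i j)
      (fun g k => (gaussResolvent A Y z g * A k * gaussResolvent A Y z g) i j) where
  hasFDerivAt := hasFDerivAt_gaussResolvent_apply hA hY (fun i => hη.trans_le (hz i)) i j
  continuous_grad := by
    have hc : ∀ a b, Continuous fun g => gaussResolvent A Y z g a b := fun a b =>
      continuous_iff_continuousAt.mpr fun g => (hasFDerivAt_gaussResolvent_apply hA hY
        (fun i => hη.trans_le (hz i)) a b g).continuousAt
    simp only [mul_apply]
    fun_prop
  bdd := ⟨1 / η, norm_gaussResolvent_apply_le hA hY hη hz i j⟩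
  bdd_grad := by
    refine ⟨∑ k, ∑ b, ∑ a, 1 / η * ‖A k a b‖ * (1 / η), fun g k => ?_⟩
    refine le_trans ?_ (Finset.single_le_sum
      (f := fun k => ∑ b, ∑ a, 1 / η * ‖A k a b‖ * (1 / η))
      (fun k _ => by positivity) (Finset.mem_univ k))
    simp only [mul_apply, Finset.sum_mul]
    refine (norm_sum_le _ _).trans (Finset.sum_le_sum fun b _ =>
      (norm_sum_le _ _).trans (Finset.sum_le_sum fun a _ => ?_))
    rw [norm_mul, norm_mul]
    have h1 := norm_gaussResolvent_apply_le hA hY hη hz i a g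
    have h2 := norm_gaussResolvent_apply_le hA hY hη hz b j g
    gcongr

/-- The variance of `Tr(C X)` for a deterministic matrix `C`. -/
theorem HasCovariance.sum_norm_sq (hA : HasCovariance A σ) (C : Matrix n n ℂ) :
    ∑ k, ‖∑ a, ∑ b, C b a * A k a b‖ ^ 2 = ∑ a, ∑ b, σ a b * ‖C b a‖ ^ 2 := by
  have hstar : ∀ k c d, star (A k c d) = A k d c := fun k c d => (hA.isHermitian k).apply d c
  have h : ((∑ k, ‖∑ a, ∑ b, C b a * A k a b‖ ^ 2 : ℝ) : ℂ)
      = ((∑ a, ∑ b, σ a b * ‖C b a‖ ^ 2 : ℝ) : ℂ) := by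
    push_cast
    calc ∑ k, (‖∑ a, ∑ b, C b a * A k a b‖ : ℂ) ^ 2
        = ∑ k, ∑ a, ∑ b, ∑ c, ∑ d, (C b a * star (C d c)) * (A k a b * A k d c) := by
          refine Finset.sum_congr rfl fun k _ => ?_
          rw [← Complex.mul_conj', ← RCLike.star_def, star_sum, Finset.sum_mul]
          refine Finset.sum_congr rfl fun a _ => ?_
          rw [Finset.sum_mul]
          refine Finset.sum_congr rfl fun b _ => ?_
          rw [Finset.mul_sum]
          refine Finset.sum_congr rfl fun c _ => ?_
          rw [star_sum, Finset.mul_sum]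
          refine Finset.sum_congr rfl fun d _ => ?_
          rw [star_mul', hstar]
          ring
      _ = ∑ a, ∑ b, ∑ c, ∑ d, (C b a * star (C d c)) * ∑ k, A k a b * A k d c := by
          rw [Finset.sum_comm]
          refine Finset.sum_congr rfl fun a _ => ?_
          rw [Finset.sum_comm]
          refine Finset.sum_congr rfl fun b _ => ?_
          rw [Finset.sum_comm]
          refine Finset.sum_congr rfl fun c _ => ?_
          rw [Finset.sum_comm]
          exact Finset.sum_congr rfl fun d _ => by rw [Finset.mul_sum]
      _ = _ := by
          refine Finset.sum_congr rfl fun a _ => Finset.sum_congr rfl fun b _ => ?_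
          rw [Finset.sum_eq_single a, Finset.sum_eq_single b]
          · rw [hA.sum_mul, if_pos ⟨rfl, rfl⟩, RCLike.star_def, Complex.mul_conj']
            ring
          · intro d _ hd
            rw [hA.sum_mul, if_neg fun h => hd h.2.symm, mul_zero]
          · simp
          · intro c _ hc
            refine Finset.sum_eq_zero fun d _ => ?_
            rw [hA.sum_mul, if_neg fun h => hc h.1.symm, mul_zero]
          · simp
  exact_mod_cast h

theorem sum_norm_inv_mul_diagonal_mul_inv_sq_le {K : Matrix n n ℂ} (hK : K.IsHermitian)
    (hη : 0 < η) (hz : ∀ i, η ≤ (z i).im) (b : n → ℝ) :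
    ∑ a, ∑ c, ‖((diagonal z - K)⁻¹ * diagonal (fun i => (b i : ℂ)) * (diagonal z - K)⁻¹) c a‖ ^ 2
      ≤ (∑ i, b i ^ 2) / η ^ 4 := by
  set R := (diagonal z - K)⁻¹ with hR
  have h1 : ∀ a, ∑ c, ‖(R * diagonal (fun i => (b i : ℂ)) * R) c a‖ ^ 2
      ≤ (∑ i, b i ^ 2 * ‖R i a‖ ^ 2) / η ^ 2 := by
    intro a
    have h := sum_norm_inv_mulVec_sq_le hK hη hz fun i => (b i : ℂ) * R i a
    rw [← hR] at h
    convert h using 4 with c _ i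
    · rw [mul_assoc, mul_apply]
      simp [mulVec, dotProduct, diagonal_mul]
    · rw [norm_mul, mul_pow, Complex.norm_real, Real.norm_eq_abs, sq_abs]
  calc _ ≤ ∑ a, (∑ i, b i ^ 2 * ‖R i a‖ ^ 2) / η ^ 2 := Finset.sum_le_sum fun a _ => h1 a
    _ = (∑ i, b i ^ 2 * ∑ a, ‖R i a‖ ^ 2) / η ^ 2 := by
        rw [← Finset.sum_div, Finset.sum_comm]
        simp only [Finset.mul_sum]
    _ ≤ (∑ i, b i ^ 2 * (1 / η ^ 2)) / η ^ 2 := by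
        have := sum_norm_inv_row_sq_le hK hη hz
        gcongr with i
        exact this i
    _ = _ := by rw [← Finset.sum_mul]; field_simp

/-- The gradient of `∑ᵢ bᵢ Rᵢᵢ` is controlled through `∂ₖ Tr(B R) = Tr(R B R Aₖ)`, where `B = diag(b)`,
and the Hilbert-Schmidt norm of `R B R`. -/
theorem exists_hasBddGrad_sum_diag (hA : HasCovariance A σ) (hY : Y.IsHermitian)
    (hη : 0 < η) (hz : ∀ i, η ≤ (z i).im) (hσ : ∀ i j, σ i j ≤ s) (b : n → ℝ) :
    ∃ F', HasBddGrad (fun g => ∑ i, (b i : ℂ) * gaussResolvent A Y z g i i) F' ∧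
      ∀ g, ∑ k, ‖F' g k‖ ^ 2 ≤ s * ((∑ i, b i ^ 2) / η ^ 4) := by
  refine ⟨_, HasBddGrad.sum Finset.univ fun i _ =>
    (hasBddGrad_gaussResolvent hA hY hη hz i i).const_mul (b i : ℂ), fun g => ?_⟩
  set R := gaussResolvent A Y z g with hR
  have h : ∀ k, ∑ i, (b i : ℂ) * (R * A k * R) i i
      = ∑ a, ∑ c, (R * diagonal (fun i => (b i : ℂ)) * R) c a * A k a c := by
    intro k
    have e : ∑ i, (b i : ℂ) * (R * A k * R) i i
        = trace (diagonal (fun i => (b i : ℂ)) * (R * A k * R)) := by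
      simp [trace, diagonal_mul]
    rw [e, show diagonal (fun i => (b i : ℂ)) * (R * A k * R)
        = (diagonal (fun i => (b i : ℂ)) * R * A k) * R by simp only [mul_assoc],
      trace_mul_comm, ← mul_assoc, ← mul_assoc, trace, Finset.sum_comm]
    simp [mul_apply]
  simp only [h]
  rw [hA.sum_norm_sq]
  rcases isEmpty_or_nonempty n with hn | ⟨⟨i₀⟩⟩
  · simp
  refine le_trans (Finset.sum_le_sum fun a _ => Finset.sum_le_sum fun c _ =>
    mul_le_mul_of_nonneg_right (hσ a c) (sq_nonneg _)) ?_
  simp only [← Finset.mul_sum]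
  have hs : 0 ≤ s := by
    have h0 := hA.sum_norm_sq (Matrix.single i₀ i₀ 1)
    have h1 : ∑ a, ∑ b, σ a b * ‖Matrix.single i₀ i₀ (1 : ℂ) b a‖ ^ 2 = σ i₀ i₀ := by
      rw [Finset.sum_eq_single i₀, Finset.sum_eq_single i₀] <;>
        simp +contextual [Matrix.single_apply, eq_comm]
    rw [h1] at h0
    exact (h0 ▸ Finset.sum_nonneg fun k _ => sq_nonneg _).trans (hσ i₀ i₀)
  exact mul_le_mul_of_nonneg_left
    (sum_norm_inv_mul_diagonal_mul_inv_sq_le (hA.isHermitian_add hY g) hη hz b) hs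

end GaussianMatrix

/-! ### The Dyson equation for the expected resolvent -/

section Dyson

open Matrix

variable {ι n : Type*} [Fintype ι] [Fintype n] [DecidableEq n]

theorem norm_integral_mul_le {F G : (ι → ℝ) → ℂ} {F' G' : (ι → ℝ) → ι → ℂ}
    (hF : HasBddGrad F F') (hG : HasBddGrad G G') :
    ‖∫ x, F x * G x ∂stdGauss ι‖
      ≤ √(∫ x, ‖F x‖ ^ 2 ∂stdGauss ι) * √(∫ x, ‖G x‖ ^ 2 ∂stdGauss ι) := by
  have hmem : ∀ {F : (ι → ℝ) → ℂ} {F' : (ι → ℝ) → ι → ℂ}, HasBddGrad F F' →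
      MemLp F (ENNReal.ofReal 2) (stdGauss ι) := fun hF =>
    let ⟨C, hC⟩ := hF.bdd
    MemLp.of_bound hF.continuous.aestronglyMeasurable C (Filter.Eventually.of_forall hC)
  refine (norm_integral_le_integral_norm _).trans ?_
  simp only [norm_mul]
  have h := integral_mul_norm_le_Lp_mul_Lq (p := 2) (q := 2)
    (by constructor <;> norm_num) (hmem hF) (hmem hG)
  simpa [Real.sqrt_eq_rpow] using h

variable {A : ι → Matrix n n ℂ} {Y : Matrix n n ℂ} {σ : Matrix n n ℝ} {z : n → ℂ} {η s : ℝ}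

/-- The entrywise expectation of the resolvent. -/
noncomputable def meanResolvent (A : ι → Matrix n n ℂ) (Y : Matrix n n ℂ) (z : n → ℂ) :
    Matrix n n ℂ :=
  fun a c => ∫ g, gaussResolvent A Y z g a c ∂stdGauss ι

/-- The centered random variable `∑_b σ(a,b) (R_bb - E[R_bb])`. -/
noncomputable def selfEnergyFluct (A : ι → Matrix n n ℂ) (Y : Matrix n n ℂ) (σ : Matrix n n ℝ)
    (z : n → ℂ) (a : n) (g : ι → ℝ) : ℂ :=
  ∑ b, (σ a b : ℂ) * gaussResolvent A Y z g b b - ∑ b, (σ a b : ℂ) * meanResolvent A Y z b b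

/-- The error term `E[ξₐ R_ac]` of the Dyson equation, where `ξₐ` is the fluctuation of the
self-energy. -/
noncomputable def dysonError (A : ι → Matrix n n ℂ) (Y : Matrix n n ℂ) (σ : Matrix n n ℝ)
    (z : n → ℂ) : Matrix n n ℂ :=
  fun a c => ∫ g, selfEnergyFluct A Y σ z a g * gaussResolvent A Y z g a c ∂stdGauss ι

theorem integral_sum_gaussMatrix_mul (hA : HasCovariance A σ) (hY : Y.IsHermitian)
    (hη : 0 < η) (hz : ∀ i, η ≤ (z i).im) (a c : n) :
    ∫ g, ∑ b, gaussMatrix A g a b * gaussResolvent A Y z g b c ∂stdGauss ι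
      = ∫ g, (∑ b, (σ a b : ℂ) * gaussResolvent A Y z g b b) * gaussResolvent A Y z g a c
        ∂stdGauss ι := by
  have hR := hasBddGrad_gaussResolvent hA hY hη hz
  calc _ = ∫ g, ∑ b, ∑ k, A k a b * ((g k : ℂ) * gaussResolvent A Y z g b c) ∂stdGauss ι := by
        refine integral_congr_ae (Filter.Eventually.of_forall fun g => ?_)
        simp only [gaussMatrix, Matrix.sum_apply, Matrix.smul_apply, smul_eq_mul, Finset.sum_mul]
        exact Finset.sum_congr rfl fun b _ => Finset.sum_congr rfl fun k _ => by ring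
    _ = ∑ b, ∑ k, A k a b * ∫ g, (gaussResolvent A Y z g * A k * gaussResolvent A Y z g) b c
          ∂stdGauss ι := by
        rw [integral_finsetSum _ fun b _ => integrable_finsetSum _ fun k _ =>
          ((hR b c).integrable_eval_mul k).const_mul _]
        refine Finset.sum_congr rfl fun b _ => ?_
        rw [integral_finsetSum _ fun k _ => ((hR b c).integrable_eval_mul k).const_mul _]
        refine Finset.sum_congr rfl fun k _ => ?_
        rw [integral_const_mul, (hR b c).integral_eval_mul k]
    _ = ∫ g, ∑ b, ∑ k, A k a b * (gaussResolvent A Y z g * A k * gaussResolvent A Y z g) b c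
          ∂stdGauss ι := by
        rw [integral_finsetSum _ fun b _ => integrable_finsetSum _ fun k _ =>
          ((hR b c).integrable_grad k).const_mul _]
        refine Finset.sum_congr rfl fun b _ => ?_
        rw [integral_finsetSum _ fun k _ => ((hR b c).integrable_grad k).const_mul _]
        refine Finset.sum_congr rfl fun k _ => ?_
        rw [integral_const_mul]
    _ = _ := by
        refine integral_congr_ae (Filter.Eventually.of_forall fun g => ?_)
        simp only
        set R := gaussResolvent A Y z g
        rw [Finset.sum_mul]
        refine Finset.sum_congr rfl fun b _ => ?_
        calc ∑ k, A k a b * (R * A k * R) b c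
            = ∑ k, ∑ e, ∑ d, R b d * R e c * (A k a b * A k d e) := by
              refine Finset.sum_congr rfl fun k _ => ?_
              simp only [mul_apply, Finset.sum_mul, Finset.mul_sum]
              exact Finset.sum_congr rfl fun e _ => Finset.sum_congr rfl fun d _ => by ring
          _ = ∑ e, ∑ d, R b d * R e c * ∑ k, A k a b * A k d e := by
              rw [Finset.sum_comm]
              refine Finset.sum_congr rfl fun e _ => ?_
              rw [Finset.sum_comm]
              exact Finset.sum_congr rfl fun d _ => by rw [Finset.mul_sum]
          _ = _ := by
              rw [Finset.sum_eq_single a, Finset.sum_eq_single b]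
              · rw [hA.sum_mul, if_pos ⟨rfl, rfl⟩]; ring
              · intro d _ hd
                rw [hA.sum_mul, if_neg fun h => hd h.2.symm, mul_zero]
              · simp
              · intro e _ he
                refine Finset.sum_eq_zero fun d _ => ?_
                rw [hA.sum_mul, if_neg fun h => he h.1.symm, mul_zero]
              · simp

/-- The Dyson equation for the expected resolvent, from `(z - H) R = 1` and Gaussian integration by
parts. -/
theorem dyson_equation (hA : HasCovariance A σ) (hY : Y.IsHermitian)
    (hη : 0 < η) (hz : ∀ i, η ≤ (z i).im) :
    (diagonal (fun a => z a - ∑ b, (σ a b : ℂ) * meanResolvent A Y z b b) - Y)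
      * meanResolvent A Y z = 1 + dysonError A Y σ z := by
  have hR := hasBddGrad_gaussResolvent hA hY hη hz
  ext a c
  have hpt : ∀ g, z a * gaussResolvent A Y z g a c
      - ∑ b, Y a b * gaussResolvent A Y z g b c
      - ∑ b, gaussMatrix A g a b * gaussResolvent A Y z g b c = (1 : Matrix n n ℂ) a c := by
    intro g
    rw [← mul_nonsing_inv _ (isUnit_det_diagonal_sub (hA.isHermitian_add hY g)
      fun i => hη.trans_le (hz i))]
    rw [sub_mul, Matrix.sub_apply, diagonal_mul, add_mul, Matrix.add_apply, mul_apply, mul_apply]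
    simp only [gaussResolvent]
    ring
  have hX : Integrable (fun g => ∑ b, gaussMatrix A g a b * gaussResolvent A Y z g b c)
      (stdGauss ι) := by
    simp only [gaussMatrix, Matrix.sum_apply, Matrix.smul_apply, smul_eq_mul, Finset.sum_mul]
    refine integrable_finsetSum _ fun b _ => integrable_finsetSum _ fun k _ => ?_
    refine (((hR b c).integrable_eval_mul k).const_mul (A k a b)).congr
      (Filter.Eventually.of_forall fun g => ?_)
    simp only; ring
  have hS : HasBddGrad (fun g => ∑ b, (σ a b : ℂ) * gaussResolvent A Y z g b b) _ :=
    HasBddGrad.sum Finset.univ fun b _ => (hR b b).const_mul _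
  have h1 : ∫ g, (z a * gaussResolvent A Y z g a c
      - ∑ b, Y a b * gaussResolvent A Y z g b c
      - ∑ b, gaussMatrix A g a b * gaussResolvent A Y z g b c) ∂stdGauss ι
      = (1 : Matrix n n ℂ) a c := by
    simp only [hpt]
    simp
  have i1 := (hR a c).integrable.const_mul (z a)
  have i2 : Integrable (fun g => ∑ b, Y a b * gaussResolvent A Y z g b c) (stdGauss ι) :=
    integrable_finsetSum _ fun b _ => (hR b c).integrable.const_mul _
  rw [integral_sub (f := fun g => z a * gaussResolvent A Y z g a c
      - ∑ b, Y a b * gaussResolvent A Y z g b c) (i1.sub i2) hX, integral_sub i1 i2,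
    integral_sum_gaussMatrix_mul hA hY hη hz, integral_const_mul,
    integral_finsetSum _ fun b _ => (hR b c).integrable.const_mul _] at h1
  simp only [integral_const_mul] at h1
  have h2 : dysonError A Y σ z a c
      = ∫ g, (∑ b, (σ a b : ℂ) * gaussResolvent A Y z g b b) * gaussResolvent A Y z g a c
        ∂stdGauss ι - (∑ b, (σ a b : ℂ) * meanResolvent A Y z b b) * meanResolvent A Y z a c := by
    simp only [dysonError, selfEnergyFluct, sub_mul]
    rw [integral_sub (hS.mul (hR a c)).integrable ((hR a c).integrable.const_mul _),
      integral_const_mul]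
    rfl
  rw [sub_mul, Matrix.sub_apply, diagonal_mul, Matrix.add_apply, h2, ← h1, mul_apply]
  simp only [meanResolvent]
  ring

theorem meanResolvent_diag_im_neg (hA : HasCovariance A σ) (hY : Y.IsHermitian)
    (hη : 0 < η) (hz : ∀ i, η ≤ (z i).im) (a : n) : (meanResolvent A Y z a a).im < 0 := by
  have hR := hasBddGrad_gaussResolvent hA hY hη hz a a
  have hneg : ∀ g, (gaussResolvent A Y z g a a).im < 0 := fun g =>
    inv_diag_im_neg (hA.isHermitian_add hY g) (fun i => hη.trans_le (hz i)) a
  have him : (meanResolvent A Y z a a).im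
      = ∫ g, (gaussResolvent A Y z g a a).im ∂stdGauss ι :=
    (integral_im hR.integrable).symm
  have hpos : 0 < ∫ g, -(gaussResolvent A Y z g a a).im ∂stdGauss ι := by
    rw [integral_pos_iff_support_of_nonneg (fun g => (neg_pos.mpr (hneg g)).le)
      hR.integrable.im.neg]
    have : Function.support (fun g => -(gaussResolvent A Y z g a a).im) = Set.univ :=
      Set.eq_univ_of_forall fun g => (neg_pos.mpr (hneg g)).ne'
    rw [this, measure_univ]
    exact one_pos
  rw [integral_neg] at hpos
  rw [him]
  linarith

theorem hasBddGrad_selfEnergyFluct (hA : HasCovariance A σ) (hY : Y.IsHermitian)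
    (hη : 0 < η) (hz : ∀ i, η ≤ (z i).im) (a : n) :
    ∃ F', HasBddGrad (selfEnergyFluct A Y σ z a) F' := by
  have hS := HasBddGrad.sum Finset.univ fun b _ =>
    (hasBddGrad_gaussResolvent hA hY hη hz b b).const_mul (σ a b : ℂ)
  have := hS.add (HasBddGrad.const (-∑ b, (σ a b : ℂ) * meanResolvent A Y z b b))
  simp only [← sub_eq_add_neg] at this
  exact ⟨_, this⟩

theorem integral_sum_mul_gaussResolvent (hA : HasCovariance A σ) (hY : Y.IsHermitian)
    (hη : 0 < η) (hz : ∀ i, η ≤ (z i).im) (w : n → ℂ) :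
    ∫ g, ∑ b, w b * gaussResolvent A Y z g b b ∂stdGauss ι
      = ∑ b, w b * meanResolvent A Y z b b := by
  rw [integral_finsetSum _ fun b _ =>
    (hasBddGrad_gaussResolvent hA hY hη hz b b).integrable.const_mul _]
  simp only [integral_const_mul]
  rfl

theorem integral_norm_selfEnergyFluct_sq_le (hA : HasCovariance A σ) (hY : Y.IsHermitian)
    (hη : 0 < η) (hz : ∀ i, η ≤ (z i).im) (hσ0 : ∀ i j, 0 ≤ σ i j) (hσ : ∀ i j, σ i j ≤ s)
    (a : n) :
    ∫ g, ‖selfEnergyFluct A Y σ z a g‖ ^ 2 ∂stdGauss ι ≤ Fintype.card n * s ^ 3 / η ^ 4 := by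
  obtain ⟨F', hF, hF'⟩ := exists_hasBddGrad_sum_diag hA hY hη hz hσ (σ a)
  have h := integral_norm_sub_integral_sq_le hF hF'
  rw [integral_sum_mul_gaussResolvent hA hY hη hz] at h
  refine h.trans ?_
  have hs : 0 ≤ s := (hσ0 a a).trans (hσ a a)
  have h1 : ∑ i, σ a i ^ 2 ≤ Fintype.card n * s ^ 2 := by
    refine (Finset.sum_le_card_nsmul _ _ (s ^ 2) fun i _ =>
      pow_le_pow_left₀ (hσ0 a i) (hσ a i) 2).trans_eq ?_
    simp
  calc s * ((∑ i, σ a i ^ 2) / η ^ 4) ≤ s * (Fintype.card n * s ^ 2 / η ^ 4) := by gcongr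
    _ = _ := by ring

theorem im_sub_selfEnergy_ge (hA : HasCovariance A σ) (hY : Y.IsHermitian)
    (hη : 0 < η) (hz : ∀ i, η ≤ (z i).im) (hσ0 : ∀ i j, 0 ≤ σ i j) (a : n) :
    η ≤ (z a - ∑ b, (σ a b : ℂ) * meanResolvent A Y z b b).im := by
  rw [Complex.sub_im, Complex.im_sum]
  have : ∑ b, ((σ a b : ℂ) * meanResolvent A Y z b b).im ≤ 0 :=
    Finset.sum_nonpos fun b _ => by
      rw [Complex.im_ofReal_mul]
      exact mul_nonpos_of_nonneg_of_nonpos (hσ0 a b) (meanResolvent_diag_im_neg hA hY hη hz b).le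
  linarith [hz a]

/-- The diagonal of the expected resolvent is an approximate fixed point. The error is
`∑ⱼ Mₐⱼ E[ξⱼ Rⱼₐ]`; the variance of `ξⱼ` is bounded by the Poincaré inequality, and the sums over a row
of `M` and over a column of `R` are bounded by `1 / η²`. -/
theorem norm_meanResolvent_sub_le (hA : HasCovariance A σ) (hY : Y.IsHermitian)
    (hη : 0 < η) (hz : ∀ i, η ≤ (z i).im) (hσ0 : ∀ i j, 0 ≤ σ i j) (hσ : ∀ i j, σ i j ≤ s)
    (a : n) :
    ‖meanResolvent A Y z a a
        - (diagonal (fun a => z a - ∑ b, (σ a b : ℂ) * meanResolvent A Y z b b) - Y)⁻¹ a a‖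
      ≤ √(Fintype.card n * s ^ 3) / η ^ 4 := by
  have hz' := im_sub_selfEnergy_ge hA hY hη hz hσ0
  have hdy := dyson_equation hA hY hη hz
  set z' := fun a => z a - ∑ b, (σ a b : ℂ) * meanResolvent A Y z b b with hzdef
  have hR := hasBddGrad_gaussResolvent hA hY hη hz
  set τ := √(Fintype.card n * s ^ 3) / η ^ 2 with hτ
  have hτ0 : 0 ≤ τ := by positivity
  have hξ : ∀ j, √(∫ g, ‖selfEnergyFluct A Y σ z j g‖ ^ 2 ∂stdGauss ι) ≤ τ := by
    intro j
    rw [hτ, show η ^ 2 = √(η ^ 4) by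
      rw [show η ^ 4 = (η ^ 2) ^ 2 by ring, Real.sqrt_sq (by positivity)],
      ← Real.sqrt_div' _ (by positivity)]
    exact Real.sqrt_le_sqrt (integral_norm_selfEnergyFluct_sq_le hA hY hη hz hσ0 hσ j)
  have hD : ∀ j, ‖dysonError A Y σ z j a‖
      ≤ τ * √(∫ g, ‖gaussResolvent A Y z g j a‖ ^ 2 ∂stdGauss ι) := by
    intro j
    obtain ⟨F', hF⟩ := hasBddGrad_selfEnergyFluct hA hY hη hz j
    exact (norm_integral_mul_le hF (hR j a)).trans
      (mul_le_mul_of_nonneg_right (hξ j) (Real.sqrt_nonneg _))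
  have hsq : ∀ j, Integrable (fun g => ‖gaussResolvent A Y z g j a‖ ^ 2) (stdGauss ι) := by
    intro j
    have hc := (hR j a).continuous
    refine Integrable.of_bound (Continuous.aestronglyMeasurable (by fun_prop)) ((1 / η) ^ 2)
      (Filter.Eventually.of_forall fun g => ?_)
    rw [norm_pow, norm_norm]
    exact pow_le_pow_left₀ (norm_nonneg _) (norm_gaussResolvent_apply_le hA hY hη hz j a g) 2
  have hcol : ∑ j, ∫ g, ‖gaussResolvent A Y z g j a‖ ^ 2 ∂stdGauss ι ≤ 1 / η ^ 2 := by
    rw [← integral_finsetSum _ fun j _ => hsq j]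
    refine (integral_mono (integrable_finsetSum _ fun j _ => hsq j) (integrable_const (1 / η ^ 2))
      fun g => sum_norm_inv_col_sq_le (hA.isHermitian_add hY g) hη hz a).trans_eq (by simp)
  have hM : meanResolvent A Y z a a - (diagonal z' - Y)⁻¹ a a
      = ∑ j, (diagonal z' - Y)⁻¹ a j * dysonError A Y σ z j a := by
    have h1 : meanResolvent A Y z
        = (diagonal z' - Y)⁻¹ + (diagonal z' - Y)⁻¹ * dysonError A Y σ z := by
      rw [← Matrix.mul_one (diagonal z' - Y)⁻¹, Matrix.mul_assoc, Matrix.one_mul, ← mul_add, ← hdy,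
        ← Matrix.mul_assoc, nonsing_inv_mul _ (isUnit_det_diagonal_sub hY
          fun i => hη.trans_le (hz' i)), Matrix.one_mul]
    have h2 := congrFun (congrFun h1 a) a
    rw [h2, Matrix.add_apply, add_sub_cancel_left, mul_apply]
  rw [hM]
  calc _ ≤ ∑ j, ‖(diagonal z' - Y)⁻¹ a j‖ *
        (τ * √(∫ g, ‖gaussResolvent A Y z g j a‖ ^ 2 ∂stdGauss ι)) := by
        refine (norm_sum_le _ _).trans (Finset.sum_le_sum fun j _ => ?_)
        rw [norm_mul]
        exact mul_le_mul_of_nonneg_left (hD j) (norm_nonneg _)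
    _ = τ * ∑ j, ‖(diagonal z' - Y)⁻¹ a j‖ *
        √(∫ g, ‖gaussResolvent A Y z g j a‖ ^ 2 ∂stdGauss ι) := by
        rw [Finset.mul_sum]
        exact Finset.sum_congr rfl fun j _ => by ring
    _ ≤ τ * (√(∑ j, ‖(diagonal z' - Y)⁻¹ a j‖ ^ 2) *
        √(∑ j, √(∫ g, ‖gaussResolvent A Y z g j a‖ ^ 2 ∂stdGauss ι) ^ 2)) :=
        mul_le_mul_of_nonneg_left (Real.sum_mul_le_sqrt_mul_sqrt _ _ _) hτ0
    _ ≤ τ * (√(1 / η ^ 2) * √(1 / η ^ 2)) := by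
        have h1 := sum_norm_inv_row_sq_le hY hη hz' a
        have h2 : ∑ j, √(∫ g, ‖gaussResolvent A Y z g j a‖ ^ 2 ∂stdGauss ι) ^ 2 ≤ 1 / η ^ 2 := by
          refine le_trans (le_of_eq (Finset.sum_congr rfl fun j _ => ?_)) hcol
          exact Real.sq_sqrt (integral_nonneg fun g => sq_nonneg _)
        gcongr
    _ = _ := by
        rw [Real.mul_self_sqrt (by positivity), hτ]
        field_simp

/-- For diagonal `Y` the error is the single covariance `Mₐₐ E[ξₐ (Rₐₐ - E[Rₐₐ])]`, and the Poincaré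
inequality applies to both factors. -/
theorem norm_meanResolvent_sub_le_of_isDiag (hA : HasCovariance A σ) (hY : Y.IsHermitian)
    (hYd : Y.IsDiag) (hη : 0 < η) (hz : ∀ i, η ≤ (z i).im) (hσ0 : ∀ i j, 0 ≤ σ i j)
    (hσ : ∀ i j, σ i j ≤ s) (a : n) :
    ‖meanResolvent A Y z a a
        - (diagonal (fun a => z a - ∑ b, (σ a b : ℂ) * meanResolvent A Y z b b) - Y)⁻¹ a a‖
      ≤ √(Fintype.card n) * s ^ 2 / η ^ 5 := by
  have hz' := im_sub_selfEnergy_ge hA hY hη hz hσ0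
  have hdy := dyson_equation hA hY hη hz
  set z' := fun a => z a - ∑ b, (σ a b : ℂ) * meanResolvent A Y z b b with hzdef
  have hs : 0 ≤ s := (hσ0 a a).trans (hσ a a)
  have hR := hasBddGrad_gaussResolvent hA hY hη hz a a
  obtain ⟨F', hF⟩ := hasBddGrad_selfEnergyFluct hA hY hη hz a
  -- For diagonal `Y` the Dyson equation decouples into scalar equations.
  have hrow : ∀ B : Matrix n n ℂ, ((diagonal z' - Y) * B) a a = (z' a - Y a a) * B a a := by
    intro B
    rw [sub_mul, Matrix.sub_apply, diagonal_mul, mul_apply, Finset.sum_eq_single a, ← sub_mul]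
    · intro b _ hb
      rw [hYd hb.symm, zero_mul]
    · simp
  have h1 : (z' a - Y a a) * (diagonal z' - Y)⁻¹ a a = 1 := by
    rw [← hrow, mul_nonsing_inv _ (isUnit_det_diagonal_sub hY fun i => hη.trans_le (hz' i)),
      one_apply_eq]
  have h2 : (z' a - Y a a) * meanResolvent A Y z a a = 1 + dysonError A Y σ z a a := by
    rw [← hrow, hdy, Matrix.add_apply, one_apply_eq]
  have hM : meanResolvent A Y z a a - (diagonal z' - Y)⁻¹ a a
      = (diagonal z' - Y)⁻¹ a a * dysonError A Y σ z a a := by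
    linear_combination (diagonal z' - Y)⁻¹ a a * h2 - meanResolvent A Y z a a * h1
  have hG := hR.add (HasBddGrad.const (-meanResolvent A Y z a a))
  simp only [← sub_eq_add_neg] at hG
  have hmean : ∫ g, selfEnergyFluct A Y σ z a g ∂stdGauss ι = 0 := by
    have hS := HasBddGrad.sum Finset.univ fun b _ =>
      (hasBddGrad_gaussResolvent hA hY hη hz b b).const_mul (σ a b : ℂ)
    simp only [selfEnergyFluct]
    rw [integral_sub hS.integrable (integrable_const _),
      integral_sum_mul_gaussResolvent hA hY hη hz]
    simp
  have hD : dysonError A Y σ z a a = ∫ g, selfEnergyFluct A Y σ z a g *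
      (gaussResolvent A Y z g a a - meanResolvent A Y z a a) ∂stdGauss ι := by
    simp only [mul_sub]
    rw [integral_sub (hF.mul hR).integrable (hF.integrable.mul_const _), integral_mul_const, hmean,
      zero_mul, sub_zero]
    rfl
  have hv1 := integral_norm_selfEnergyFluct_sq_le hA hY hη hz hσ0 hσ a
  have hv2 : ∫ g, ‖gaussResolvent A Y z g a a - meanResolvent A Y z a a‖ ^ 2 ∂stdGauss ι
      ≤ s / η ^ 4 := by
    obtain ⟨F', hF, hF'⟩ := exists_hasBddGrad_sum_diag hA hY hη hz hσ (Pi.single a 1)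
    have h := integral_norm_sub_integral_sq_le hF hF'
    rw [integral_sum_mul_gaussResolvent hA hY hη hz (fun i => ((Pi.single a 1 : n → ℝ) i : ℂ))] at h
    have e : ∀ f : n → ℂ, ∑ i, ((Pi.single a 1 : n → ℝ) i : ℂ) * f i = f a := by
      intro f
      rw [Finset.sum_eq_single a] <;> simp +contextual
    have e2 : ∑ i, (Pi.single a 1 : n → ℝ) i ^ 2 = 1 := by
      rw [Finset.sum_eq_single a] <;> simp +contextual
    simp only [e, e2] at h
    exact h.trans_eq (by ring)
  rw [hM, norm_mul, hD]
  calc _ ≤ 1 / η * (√(Fintype.card n * s ^ 3 / η ^ 4) * √(s / η ^ 4)) := by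
        refine mul_le_mul (norm_inv_apply_le hY hη hz' a a) ((norm_integral_mul_le hF hG).trans ?_)
          (norm_nonneg _) (by positivity)
        gcongr
    _ = _ := by
        rw [← Real.sqrt_mul (by positivity), show (Fintype.card n : ℝ) * s ^ 3 / η ^ 4 * (s / η ^ 4)
          = Fintype.card n * (s ^ 2 / η ^ 4) ^ 2 by ring, Real.sqrt_mul (by positivity),
          Real.sqrt_sq (by positivity)]
        field_simp

end Dyson

/-! ### Realization of the GUE by independent real Gaussian variables -/

section Model

open Matrix

variable {N : ℕ}

/-- The positions on and below the diagonal of an `N × N` matrix. -/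
abbrev LowerIdx (N : ℕ) : Type := {p : Fin N × Fin N // p.2 ≤ p.1}

/-- The lower-triangular position carrying the entries `(i, j)` and `(j, i)`. -/
def sortIdx (i j : Fin N) : LowerIdx N := ⟨(max i j, min i j), min_le_max⟩

theorem sortIdx_eq_iff {a b c d : Fin N} :
    sortIdx a b = sortIdx c d ↔ (a = c ∧ b = d) ∨ (a = d ∧ b = c) := by
  simp only [sortIdx, Subtype.mk.injEq, Prod.mk.injEq]
  rcases le_total a b with h | h <;> rcases le_total c d with h' | h' <;>
    simp only [h, h', max_eq_left, max_eq_right, min_eq_left, min_eq_right] <;>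
    constructor <;> intro H <;> grind

/-- The coefficient of the real Gaussian variable `g (inl p)` in the entry `(i, j)` at position `p`. -/
noncomputable def coefRe (i j : Fin N) : ℂ := if i = j then 1 else ((√2)⁻¹ : ℝ)

/-- The coefficient of the real Gaussian variable `g (inr p)` in the entry `(i, j)` at position `p`. It
vanishes on the diagonal, whose entries use one real Gaussian variable only. -/
noncomputable def coefIm (i j : Fin N) : ℂ :=
  if i = j then 0 else if j < i then ((√2)⁻¹ : ℝ) * Complex.I else -(((√2)⁻¹ : ℝ) * Complex.I)

/-- The Hermitian matrices `Bₖ` for which `∑ₖ gₖ Bₖ`, with `g` standard Gaussian, has the law of an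
unnormalized GUE matrix. -/
noncomputable def gueCoef : LowerIdx N ⊕ LowerIdx N → Matrix (Fin N) (Fin N) ℂ
  | Sum.inl p => fun i j => if sortIdx i j = p then coefRe i j else 0
  | Sum.inr p => fun i j => if sortIdx i j = p then coefIm i j else 0

theorem gaussMatrix_gueCoef_apply (g : LowerIdx N ⊕ LowerIdx N → ℝ) (i j : Fin N) :
    gaussMatrix gueCoef g i j
      = (g (Sum.inl (sortIdx i j)) : ℂ) * coefRe i j
        + (g (Sum.inr (sortIdx i j)) : ℂ) * coefIm i j := by
  simp [gaussMatrix, Matrix.sum_apply, gueCoef]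

theorem sum_gueCoef_mul (a b c d : Fin N) :
    ∑ k, gueCoef k a b * gueCoef k c d = if a = d ∧ b = c then (1 : ℂ) else 0 := by
  have hs : (((√2)⁻¹ : ℝ) : ℂ) * (((√2)⁻¹ : ℝ) : ℂ) = 1 / 2 := by
    rw [← Complex.ofReal_mul, ← mul_inv, Real.mul_self_sqrt zero_le_two]
    norm_num
  have e : ∑ k, gueCoef k a b * gueCoef k c d
      = if sortIdx a b = sortIdx c d then coefRe a b * coefRe c d + coefIm a b * coefIm c d
        else 0 := by
    simp [gueCoef]
    split_ifs <;> simp_all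
  rw [e]
  by_cases hab : a = b
  · subst hab
    by_cases hcd : c = d
    · subst hcd
      simp [sortIdx_eq_iff, coefRe, coefIm]
    · have : ¬ (sortIdx a a = sortIdx c d) := by
        rw [sortIdx_eq_iff]; grind
      rw [if_neg this, if_neg (by grind)]
  · by_cases h1 : a = d ∧ b = c
    · obtain ⟨rfl, rfl⟩ := h1
      rw [if_pos (sortIdx_eq_iff.mpr (Or.inr ⟨rfl, rfl⟩)), if_pos ⟨rfl, rfl⟩]
      have hba : ¬ b = a := fun h => hab h.symm
      rcases lt_or_gt_of_ne hab with h | h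
      · simp only [coefRe, coefIm, hab, hba, if_false, h, if_true, h.asymm]
        linear_combination (1 - Complex.I * Complex.I) * hs - (1 / 2) * Complex.I_mul_I
      · simp only [coefRe, coefIm, hab, hba, if_false, h, if_true, h.asymm]
        linear_combination (1 - Complex.I * Complex.I) * hs - (1 / 2) * Complex.I_mul_I
    · rw [if_neg h1]
      split_ifs with h2
      · rcases sortIdx_eq_iff.mp h2 with h3 | h3
        · obtain ⟨rfl, rfl⟩ := h3
          simp only [coefRe, coefIm, hab, if_false]
          split_ifs
          all_goals linear_combination (1 + Complex.I * Complex.I) * hs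
            + (1 / 2) * Complex.I_mul_I
        · exact (h1 h3).elim
      · rfl

theorem gueCoef_isHermitian (k : LowerIdx N ⊕ LowerIdx N) : (gueCoef k).IsHermitian := by
  have hsymm : ∀ i j : Fin N, sortIdx j i = sortIdx i j := fun i j =>
    sortIdx_eq_iff.mpr (Or.inr ⟨rfl, rfl⟩)
  refine IsHermitian.ext fun i j => ?_
  rcases k with p | p
  · simp only [gueCoef, hsymm i j]
    split_ifs
    · simp only [coefRe, eq_comm (a := j)]
      split_ifs
      · simp
      · rw [RCLike.star_def, Complex.conj_ofReal]
    · simp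
  · simp only [gueCoef, hsymm i j]
    split_ifs
    · rcases lt_trichotomy i j with h | h | h
      · simp [coefIm, h.ne, h.ne', h, h.asymm]
      · subst h; simp [coefIm]
      · simp [coefIm, h.ne, h.ne', h, h.asymm]
    · simp

variable {Γ : Matrix (Fin N) (Fin N) ℝ}

theorem gaussMatrix_withProfile (g : LowerIdx N ⊕ LowerIdx N → ℝ) :
    gaussMatrix (fun k => withProfile Γ (gueCoef k)) g = withProfile Γ (gaussMatrix gueCoef g) := by
  ext i j
  simp only [gaussMatrix, Matrix.sum_apply, Matrix.smul_apply, smul_eq_mul, withProfile, of_apply,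
    Finset.sum_div, Finset.mul_sum]
  exact Finset.sum_congr rfl fun k _ => by ring

theorem hasCovariance_withProfile (hΓsymm : Γ.IsSymm) (hΓ : ∀ i j, 0 ≤ Γ i j) :
    HasCovariance (fun k => withProfile Γ (gueCoef k)) (fun i j => Γ i j / N) where
  isHermitian k := by
    refine IsHermitian.ext fun i j => ?_
    simp only [withProfile, of_apply]
    rw [hΓsymm.apply, ← (gueCoef_isHermitian k).apply i j]
    simp
  sum_mul a b c d := by
    have h := sum_gueCoef_mul a b c d
    have e : ∑ k, withProfile Γ (gueCoef k) a b * withProfile Γ (gueCoef k) c d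
        = ((√(Γ a b) : ℝ) : ℂ) / ((√(N : ℝ) : ℝ) : ℂ)
          * (((√(Γ c d) : ℝ) : ℂ) / ((√(N : ℝ) : ℝ) : ℂ))
          * ∑ k, gueCoef k a b * gueCoef k c d := by
      rw [Finset.mul_sum]
      exact Finset.sum_congr rfl fun k _ => by simp only [withProfile, of_apply]; ring
    rw [e, h]
    split_ifs with hc
    · obtain ⟨rfl, rfl⟩ := hc
      rw [hΓsymm.apply, mul_one, ← Complex.ofReal_div, ← Complex.ofReal_mul,
        div_mul_div_comm, Real.mul_self_sqrt (hΓ _ _), Real.mul_self_sqrt N.cast_nonneg]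
    · rw [mul_zero]

/-- The matrix with prescribed entries on and below the diagonal and their conjugates above it. -/
def hermOfLower (e : LowerIdx N → ℂ) : Matrix (Fin N) (Fin N) ℂ :=
  fun i j => if j ≤ i then e (sortIdx i j) else star (e (sortIdx i j))

/-- The entry at position `p` as a function of its two real Gaussian variables. -/
noncomputable def gueEntry (p : LowerIdx N) (q : ℝ × ℝ) : ℂ :=
  q.1 * coefRe p.1.1 p.1.2 + q.2 * coefIm p.1.1 p.1.2

theorem measurable_gueEntry (p : LowerIdx N) : Measurable (gueEntry p) := by
  unfold gueEntry
  fun_prop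

theorem hermOfLower_gueEntry (g : LowerIdx N ⊕ LowerIdx N → ℝ) :
    hermOfLower (fun p => gueEntry p (g (Sum.inl p), g (Sum.inr p))) = gaussMatrix gueCoef g := by
  ext i j
  rw [gaussMatrix_gueCoef_apply, hermOfLower]
  rcases lt_trichotomy i j with h | h | h
  · rw [if_neg (not_le.mpr h)]
    simp [gueEntry, sortIdx, h.le, coefRe, coefIm, h.ne, h.ne', h, h.asymm]
  · subst h; simp [gueEntry, sortIdx, coefRe, coefIm]
  · rw [if_pos h.le]
    simp [gueEntry, sortIdx, h.le]

theorem hermOfLower_of_isHermitian {x : Matrix (Fin N) (Fin N) ℂ} (hx : x.IsHermitian) :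
    hermOfLower (fun p => x p.1.1 p.1.2) = x := by
  ext i j
  rw [hermOfLower]
  split_ifs with h
  · simp [sortIdx, h]
  · rw [not_le] at h
    simp only [sortIdx, h.le, max_eq_right, min_eq_left]
    exact hx.apply i j

theorem map_gueEntry_stdGauss :
    (stdGauss (LowerIdx N ⊕ LowerIdx N)).map
        (fun g p => gueEntry p (g (Sum.inl p), g (Sum.inr p)))
      = Measure.pi fun p => ((gaussianReal 0 1).prod (gaussianReal 0 1)).map (gueEntry p) := by
  have : ∀ p : LowerIdx N, IsProbabilityMeasure
      (((gaussianReal 0 1).prod (gaussianReal 0 1)).map (gueEntry p)) := fun p =>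
    Measure.isProbabilityMeasure_map (measurable_gueEntry p).aemeasurable
  have h1 := measurePreserving_sumPiEquivProdPi
    (X := fun _ : LowerIdx N ⊕ LowerIdx N => ℝ) (fun _ => gaussianReal 0 1)
  have h2 := (measurePreserving_arrowProdEquivProdArrow ℝ ℝ (LowerIdx N)
    (fun _ => gaussianReal 0 1) (fun _ => gaussianReal 0 1)).symm
  have h3 : MeasurePreserving (fun (y : LowerIdx N → ℝ × ℝ) p => gueEntry p (y p))
      (Measure.pi fun _ => (gaussianReal 0 1).prod (gaussianReal 0 1))
      (Measure.pi fun p => ((gaussianReal 0 1).prod (gaussianReal 0 1)).map (gueEntry p)) :=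
    ⟨measurable_pi_lambda _ fun p => (measurable_gueEntry p).comp (measurable_pi_apply p),
      Measure.pi_map_pi fun p => (measurable_gueEntry p).aemeasurable⟩
  exact (h3.comp (h2.comp h1)).map_eq

variable {Ω : Type*} [MeasurableSpace Ω] {P : Measure Ω} {x : Ω → Matrix (Fin N) (Fin N) ℂ}

theorem stdComplexGaussian_eq_map (p : LowerIdx N) (hp : p.1.2 < p.1.1) :
    stdComplexGaussian = ((gaussianReal 0 1).prod (gaussianReal 0 1)).map (gueEntry p) := by
  have h : gaussianReal 0 (1 / 2) = (gaussianReal 0 1).map (fun t => t * (√2)⁻¹) := by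
    rw [gaussianReal_map_mul_const]
    congr 1
    · simp
    · ext; simp
  rw [stdComplexGaussian, h, Measure.map_prod_map _ _ (by fun_prop) (by fun_prop),
    Measure.map_map (by fun_prop) (by fun_prop)]
  congr 1
  funext q
  simp only [Function.comp, Prod.map, gueEntry, coefRe, coefIm, hp.ne', if_false, hp, if_true]
  push_cast
  ring

theorem IsUnnormalizedGUE.map_entry_eq (hx : IsUnnormalizedGUE x P) (p : LowerIdx N) :
    AEMeasurable (fun ω => x ω p.1.1 p.1.2) P ∧
    P.map (fun ω => x ω p.1.1 p.1.2)
      = ((gaussianReal 0 1).prod (gaussianReal 0 1)).map (gueEntry p) := by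
  rcases p.2.lt_or_eq with h | h
  · rw [← stdComplexGaussian_eq_map p h]
    exact ⟨(hx.offDiag_law _ _ h).aemeasurable, (hx.offDiag_law _ _ h).map_eq⟩
  · have hd := hx.diag_law p.1.1
    have e : (fun ω => x ω p.1.1 p.1.2) = Complex.ofReal ∘ fun ω => (x ω p.1.1 p.1.1).re := by
      funext ω
      simp only [h, Function.comp]
      exact (Complex.conj_eq_iff_re.mp ((hx.isHermitian ω).apply _ _)).symm
    rw [e]
    refine ⟨Complex.measurable_ofReal.comp_aemeasurable hd.aemeasurable, ?_⟩
    rw [← AEMeasurable.map_map_of_aemeasurable Complex.measurable_ofReal.aemeasurable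
      hd.aemeasurable, hd.map_eq]
    have e2 : gueEntry p = Complex.ofReal ∘ Prod.fst := by
      funext q
      simp [gueEntry, coefRe, coefIm, h]
    rw [e2, ← Measure.map_map Complex.measurable_ofReal measurable_fst]
    congr 1
    exact measurePreserving_fst.map_eq.symm

/-- Probabilities of events about an unnormalized GUE matrix are computed in the model `∑ₖ gₖ Bₖ`. -/
theorem IsUnnormalizedGUE.measureReal_eq (hx : IsUnnormalizedGUE x P)
    {S : Set (Matrix (Fin N) (Fin N) ℂ)} (hS : MeasurableSet (hermOfLower ⁻¹' S)) :
    P.real {ω | x ω ∈ S}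
      = (stdGauss (LowerIdx N ⊕ LowerIdx N)).real {g | gaussMatrix gueCoef g ∈ S} := by
  have hmeas := fun p => (hx.map_entry_eq p).1
  have h1 : P.map (fun ω (p : LowerIdx N) => x ω p.1.1 p.1.2)
      = Measure.pi fun p => ((gaussianReal 0 1).prod (gaussianReal 0 1)).map (gueEntry p) := by
    rw [hx.indep.map_fun_eq_pi_map hmeas]
    congr 1
    funext p
    exact (hx.map_entry_eq p).2
  rw [← map_gueEntry_stdGauss] at h1
  have hmeas' : Measurable fun (g : LowerIdx N ⊕ LowerIdx N → ℝ) (p : LowerIdx N) =>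
      gueEntry p (g (Sum.inl p), g (Sum.inr p)) :=
    measurable_pi_lambda _ fun p => (measurable_gueEntry p).comp
      ((measurable_pi_apply _).prodMk (measurable_pi_apply _))
  have h2 := congrArg (fun μ => μ.real (hermOfLower ⁻¹' S)) h1
  simp only [Measure.real] at h2 ⊢
  rw [Measure.map_apply_of_aemeasurable (aemeasurable_pi_lambda _ hmeas) hS,
    Measure.map_apply hmeas' hS] at h2
  convert h2 using 3
  · ext ω
    simp only [Set.mem_ofPred_eq, Set.mem_preimage, hermOfLower_of_isHermitian (hx.isHermitian ω)]
  · ext g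
    simp only [Set.mem_ofPred_eq, Set.mem_preimage, hermOfLower_gueEntry]

theorem measurable_hermOfLower_apply (i j : Fin N) :
    Measurable fun e : LowerIdx N → ℂ => hermOfLower e i j := by
  unfold hermOfLower
  split_ifs <;> fun_prop

theorem measurable_stieltjes_withProfile (Y : Matrix (Fin N) (Fin N) ℂ) (z : ℂ) :
    Measurable fun e : LowerIdx N → ℂ =>
      stieltjes (withProfile Γ (hermOfLower e) + Y) z := by
  have hc : ∀ i, Measurable fun M : Fin N → Fin N → ℂ => (of M)⁻¹ i i := by
    intro i
    simp only [inv_def, Matrix.smul_apply, smul_eq_mul, Ring.inverse_eq_inv']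
    have h1 : Continuous fun M : Fin N → Fin N → ℂ => (of M).det :=
      Continuous.matrix_det continuous_id
    have h2 : Continuous fun M : Fin N → Fin N → ℂ => (of M).adjugate i i :=
      (Continuous.matrix_adjugate continuous_id).matrix_elem i i
    exact h1.measurable.inv.mul h2.measurable
  have hM : Measurable fun (e : LowerIdx N → ℂ) (i j : Fin N) =>
      (Matrix.scalar (Fin N) z - (withProfile Γ (hermOfLower e) + Y)) i j := by
    refine measurable_pi_lambda _ fun i => measurable_pi_lambda _ fun j => ?_
    simp only [Matrix.sub_apply, Matrix.add_apply, withProfile, of_apply]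
    have := measurable_hermOfLower_apply i j
    fun_prop
  simp only [stieltjes, trace, diag_apply]
  exact (Finset.measurable_fun_sum _ fun i _ => (hc i).comp hM).const_mul _

end Model

/-! ### Stability of the fixed point equation -/

section Bias

open Matrix

variable {N : ℕ} {Γ : Matrix (Fin N) (Fin N) ℝ} {Y : Matrix (Fin N) (Fin N) ℂ}

theorem le_gammaMax_sq (hΓ : ∀ i j, 0 ≤ Γ i j) (i j : Fin N) : Γ i j ≤ gammaMax Γ ^ 2 := by
  have h : Γ i j ≤ ⨆ p : Fin N × Fin N, Γ p.1 p.2 :=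
    le_ciSup (f := fun p : Fin N × Fin N => Γ p.1 p.2) (Set.finite_range _).bddAbove (i, j)
  rw [gammaMax, Real.sq_sqrt ((hΓ i j).trans h)]
  exact h

theorem norm_covMap_le_of_le (hΓ : ∀ i j, 0 ≤ Γ i j) {γ θ : ℝ} (hγ : ∀ i j, Γ i j ≤ γ ^ 2)
    {D : Fin N → ℂ} (hD : ∀ i, ‖D i‖ ≤ θ) (i : Fin N) : ‖covMap Γ D i‖ ≤ γ ^ 2 * θ := by
  have hN : (0 : ℝ) < N := by exact_mod_cast i.pos
  refine (norm_covMap_le hΓ D i).trans ?_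
  calc ∑ j, Γ i j / N * ‖D j‖ ≤ ∑ _j : Fin N, γ ^ 2 / N * θ := by
        refine Finset.sum_le_sum fun j _ => mul_le_mul ?_ (hD j) (norm_nonneg _) (by positivity)
        exact div_le_div_of_nonneg_right (hγ i j) hN.le
    _ = γ ^ 2 * θ := by
        rw [Finset.sum_const, Finset.card_univ, Fintype.card_fin, nsmul_eq_mul]
        field_simp

/-- Stability of the fixed point equation. If `E` solves it up to an error `θ`, then `D' = fixMap E`
solves it exactly for the shifted parameter `z - R_N(E - D')`, whose imaginary part is still at least
`δ Im z`, and the Lipschitz estimate for fixed points compares `D'` with `D`. -/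
theorem norm_sub_fixedPoint_le (hΓ : ∀ i j, 0 ≤ Γ i j) (hY : Y.IsHermitian) {γ δ θ : ℝ}
    (hγ : ∀ i j, Γ i j ≤ γ ^ 2) (hδ : 0 < δ) {z : ℂ} (hz : 0 < z.im) {D E : Fin N → ℂ}
    (hD : D ∈ lowerDiag N) (hfix : D = fixMap Γ Y (fun _ => z) D) (hE : E ∈ lowerDiag N)
    (hEθ : ∀ i, ‖E i - fixMap Γ Y (fun _ => z) E i‖ ≤ θ) (hθ0 : 0 ≤ θ)
    (hθ : γ ^ 2 * θ ≤ (1 - δ) * z.im) (i : Fin N) :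
    ‖E i - D i‖ ≤ (1 + γ ^ 2 / (δ * z.im ^ 2)) * θ := by
  have hL : (fun _ => z) ∈ upperDiag N := fun _ => hz
  set D' := fixMap Γ Y (fun _ => z) E with hD'def
  have hD' : D' ∈ lowerDiag N := fixMap_mem_lowerDiag hΓ hY hL fun j => (hE j).le
  -- `D'` is an exact fixed point for the shifted parameter `L'`.
  set L' : Fin N → ℂ := (fun _ => z) - covMap Γ (E - D') with hL'def
  have hcov : ∀ j, ‖covMap Γ (E - D') j‖ ≤ γ ^ 2 * θ := norm_covMap_le_of_le hΓ hγ hEθ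
  have hL'im : ∀ j, δ * z.im ≤ (L' j).im := by
    intro j
    have h1 : (covMap Γ (E - D') j).im ≤ γ ^ 2 * θ :=
      ((le_abs_self _).trans (Complex.abs_im_le_norm _)).trans (hcov j)
    simp only [hL'def, Pi.sub_apply, Complex.sub_im]
    linarith
  have hδz : 0 < δ * z.im := mul_pos hδ hz
  have hL' : L' ∈ upperDiag N := fun j => hδz.trans_le (hL'im j)
  have hfix' : D' = fixMap Γ Y L' D' := by
    funext j
    have e : (fun _ => z) - covMap Γ E = L' - covMap Γ D' := by
      rw [hL'def, covMap_sub]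
      abel
    change fixMap Γ Y (fun _ => z) E j = _
    rw [fixMap_apply, fixMap_apply, e]
  have hsq : 0 < √(z.im * (δ * z.im)) := Real.sqrt_pos.mpr (mul_pos hz hδz)
  have hκ : 0 ≤ γ ^ 2 * θ / √(z.im * (δ * z.im)) := by positivity
  have hmain := norm_sub_le_of_fixedPoints hΓ hY hL hL' hD hD' hfix hfix' hκ (fun j => by
    have h1 : z - L' j = covMap Γ (E - D') j := by simp [hL'def]
    rw [h1, div_mul_eq_mul_div, le_div_iff₀ hsq]
    exact mul_le_mul (hcov j) (Real.sqrt_le_sqrt (mul_le_mul_of_nonneg_left (hL'im j) hz.le))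
      hsq.le (by positivity)) i
  have hDle : -(D i).im ≤ 1 / z.im := by
    rw [hfix]
    exact ((neg_le_abs _).trans (Complex.abs_im_le_norm _)).trans
      (norm_fixMap_le hΓ hY hz (fun _ => le_rfl) (fun j => (hD j).le) i)
  have hDle' : -(D' i).im ≤ 1 / (δ * z.im) := by
    rw [hfix']
    exact ((neg_le_abs _).trans (Complex.abs_im_le_norm _)).trans
      (norm_fixMap_le hΓ hY hδz hL'im (fun j => (hD' j).le) i)
  have h2 : √(-(D i).im * -(D' i).im) ≤ 1 / √(z.im * (δ * z.im)) := by
    rw [← Real.sqrt_one, ← Real.sqrt_div zero_le_one]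
    refine Real.sqrt_le_sqrt ((mul_le_mul hDle hDle' (neg_pos.mpr (hD' i)).le
      (by positivity)).trans_eq ?_)
    rw [div_mul_div_comm, one_mul]
  have h3 : ‖D i - D' i‖ ≤ γ ^ 2 / (δ * z.im ^ 2) * θ := by
    refine (hmain.trans (mul_le_mul_of_nonneg_left h2 hκ)).trans_eq ?_
    rw [div_mul_div_comm, Real.mul_self_sqrt (by positivity)]
    field_simp
  calc ‖E i - D i‖ = ‖(E i - D' i) - (D i - D' i)‖ := by congr 1; ring
    _ ≤ θ + γ ^ 2 / (δ * z.im ^ 2) * θ := (norm_sub_le _ _).trans (add_le_add (hEθ i) h3)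
    _ = _ := by ring

end Bias

/-! ### Deviation of the Stieltjes transform -/

section Deviation

open Matrix

variable {N : ℕ} {Γ : Matrix (Fin N) (Fin N) ℝ} {Y : Matrix (Fin N) (Fin N) ℂ}

theorem stieltjes_eq_sum (K : Matrix (Fin N) (Fin N) ℂ) (z : ℂ) :
    stieltjes K z = ∑ i, ((1 / N : ℝ) : ℂ) * (diagonal (fun _ : Fin N => z) - K)⁻¹ i i := by
  rw [stieltjes, scalar_apply, trace, Finset.mul_sum]
  push_cast
  rfl

theorem stdGauss_stieltjes_deviation_le (hN : 1 ≤ N) (hΓsymm : Γ.IsSymm)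
    (hΓ : ∀ i j, 0 ≤ Γ i j) (hY : Y.IsHermitian) (hγ : 0 < gammaMax Γ) {z : ℂ} (hz : 0 < z.im)
    {L : ℝ} (hL : Real.log 2 ≤ L) :
    (stdGauss (LowerIdx N ⊕ LowerIdx N)).real {g | 4 * (gammaMax Γ ^ 2 / (N ^ 2 * z.im ^ 4)) * L
      ≤ ‖stieltjes (withProfile Γ (gaussMatrix gueCoef g) + Y) z
        - ∑ i, ((1 / N : ℝ) : ℂ) *
          meanResolvent (fun k => withProfile Γ (gueCoef k)) Y (fun _ => z) i i‖ ^ 2}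
      ≤ Real.exp (-L) := by
  have hN0 : (0 : ℝ) < N := by exact_mod_cast hN
  have hA := hasCovariance_withProfile hΓsymm hΓ
  obtain ⟨F', hF, hF'⟩ := exists_hasBddGrad_sum_diag hA hY hz (fun _ => le_rfl)
    (z := fun _ => z) (s := gammaMax Γ ^ 2 / N)
    (fun i j => div_le_div_of_nonneg_right (le_gammaMax_sq hΓ i j) hN0.le) (fun _ => 1 / (N : ℝ))
  have hmean := integral_sum_mul_gaussResolvent hA hY hz (z := fun _ => z) (fun _ => le_rfl)
    (fun _ => ((1 / N : ℝ) : ℂ))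
  have hW := hF.add (HasBddGrad.const (-∑ i, ((1 / N : ℝ) : ℂ) *
    meanResolvent (fun k => withProfile Γ (gueCoef k)) Y (fun _ => z) i i))
  simp only [Pi.zero_apply, add_zero, ← sub_eq_add_neg] at hW
  have h := measure_norm_sq_ge_le hW (V := gammaMax Γ ^ 2 / (N ^ 2 * z.im ^ 4))
    (by rw [integral_sub hF.integrable (integrable_const _), hmean]; simp) (by positivity)
    (fun g => (hF' g).trans_eq (by
      rw [Finset.sum_const, Finset.card_univ, Fintype.card_fin, nsmul_eq_mul]; field_simp)) hL
  convert h using 6 with g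
  rw [stieltjes_eq_sum, ← gaussMatrix_withProfile]
  rfl

/-- Common form of the two deviation bounds: `t` bounds the fluctuation of the Stieltjes transform and
`θ` the error in the fixed point equation for the expected resolvent. -/
theorem measureReal_deviation_le (hN : 1 ≤ N) (hΓsymm : Γ.IsSymm) (hΓ : ∀ i j, 0 ≤ Γ i j)
    (hY : Y.IsHermitian) {G : (Fin N → ℂ) → (Fin N → ℂ)} (hG : IsDetEquiv Γ Y G)
    {Ω : Type*} [MeasurableSpace Ω] (P : Measure Ω) [IsProbabilityMeasure P]
    {x : Ω → Matrix (Fin N) (Fin N) ℂ} (hx : IsUnnormalizedGUE x P) (hγ : 0 < gammaMax Γ)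
    {δ d θ t ε : ℝ} (hδ : 0 < δ) (hd : N = 1 ∨ 2 ≤ (N : ℝ) ^ d) {z : ℂ} (hz : 0 < z.im)
    (hθ0 : 0 ≤ θ) (hθ : gammaMax Γ ^ 2 * θ ≤ (1 - δ) * z.im)
    (hEθ : ∀ i, ‖meanResolvent (fun k => withProfile Γ (gueCoef k)) Y (fun _ => z) i i
      - fixMap Γ Y (fun _ => z)
        (fun i => meanResolvent (fun k => withProfile Γ (gueCoef k)) Y (fun _ => z) i i) i‖ ≤ θ)
    (ht0 : 0 ≤ t) (ht : t ^ 2 = 4 * (gammaMax Γ ^ 2 / (N ^ 2 * z.im ^ 4)) * (d * Real.log N))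
    (hε : ε = t + (1 + gammaMax Γ ^ 2 / (δ * z.im ^ 2)) * θ) :
    P.real {ω | ε ≤ ‖stieltjes (withProfile Γ (x ω) + Y) z - scalarTrace G z‖}
      ≤ (N : ℝ) ^ (-d) := by
  rcases hd with rfl | hd
  · simp
  have hN0 : (0 : ℝ) < N := by exact_mod_cast hN
  have hA := hasCovariance_withProfile hΓsymm hΓ
  have hS : MeasurableSet (hermOfLower ⁻¹' {M : Matrix (Fin N) (Fin N) ℂ |
      ε ≤ ‖stieltjes (withProfile Γ M + Y) z - scalarTrace G z‖}) :=
    measurableSet_le measurable_const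
      ((measurable_stieltjes_withProfile Y z).sub measurable_const).norm
  have hlaw := hx.measureReal_eq hS
  simp only [Set.mem_ofPred_eq] at hlaw
  rw [hlaw]
  have hlog : Real.log 2 ≤ d * Real.log N := by
    rw [← Real.log_rpow hN0]
    exact Real.log_le_log two_pos hd
  have hdev := stdGauss_stieltjes_deviation_le hN hΓsymm hΓ hY hγ hz hlog
  have hexp : Real.exp (-(d * Real.log N)) = (N : ℝ) ^ (-d) := by
    rw [Real.rpow_def_of_pos hN0]; congr 1; ring
  rw [hexp] at hdev
  refine (measureReal_mono fun g hg => ?_).trans hdev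
  simp only [Set.mem_ofPred_eq] at hg ⊢
  rw [← ht]
  set E := fun i => meanResolvent (fun k => withProfile Γ (gueCoef k)) Y (fun _ => z) i i with hE
  have hup : (fun _ => z) ∈ upperDiag N := fun _ => hz
  have hbias : ∀ i, ‖E i - G (fun _ => z) i‖ ≤ (1 + gammaMax Γ ^ 2 / (δ * z.im ^ 2)) * θ :=
    norm_sub_fixedPoint_le hΓ hY (le_gammaMax_sq hΓ) hδ hz (hG.mapsTo hup) (hG.fixedPoint _ hup)
      (fun i => meanResolvent_diag_im_neg hA hY hz (fun _ => le_rfl) i) hEθ hθ0 hθ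
  have hsum : ‖∑ i, ((1 / N : ℝ) : ℂ) * E i - scalarTrace G z‖
      ≤ (1 + gammaMax Γ ^ 2 / (δ * z.im ^ 2)) * θ := by
    have e : ∑ i, ((1 / N : ℝ) : ℂ) * E i - scalarTrace G z
        = ∑ i, ((1 / N : ℝ) : ℂ) * (E i - G (fun _ => z) i) := by
      rw [scalarTrace, trace_diagonal, Finset.mul_sum, ← Finset.sum_sub_distrib]
      exact Finset.sum_congr rfl fun i _ => by push_cast; ring
    rw [e]
    calc _ ≤ ∑ _i : Fin N, 1 / (N : ℝ) * ((1 + gammaMax Γ ^ 2 / (δ * z.im ^ 2)) * θ) := by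
          refine (norm_sum_le _ _).trans (Finset.sum_le_sum fun i _ => ?_)
          rw [norm_mul, Complex.norm_real, Real.norm_of_nonneg (by positivity)]
          exact mul_le_mul_of_nonneg_left (hbias i) (by positivity)
      _ = _ := by
          rw [Finset.sum_const, Finset.card_univ, Fintype.card_fin, nsmul_eq_mul]
          field_simp
  refine pow_le_pow_left₀ ht0 ?_ 2
  have htri := norm_sub_le_norm_sub_add_norm_sub
    (stieltjes (withProfile Γ (gaussMatrix gueCoef g) + Y) z)
    (∑ i, ((1 / N : ℝ) : ℂ) * E i) (scalarTrace G z)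
  linarith

theorem sq_mul_errGeneral_bias_le {γ η δ n : ℝ} (hγ : 0 < γ) (hη : 0 < η) (hn : 0 < n)
    (hδ : 0 < 1 - δ) (h : γ * (2 / (n * (1 - δ))) ^ (1 / 5 : ℝ) ≤ η) :
    γ ^ 2 * (2 * γ ^ 3 / (n * η ^ 4)) ≤ (1 - δ) * η := by
  have hc : (0 : ℝ) ≤ 2 / (n * (1 - δ)) := by positivity
  have h5 := pow_le_pow_left₀ (by positivity) h 5
  rw [mul_pow, ← Real.rpow_natCast (_ ^ (1 / 5 : ℝ)), ← Real.rpow_mul hc,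
    show (1 / 5 : ℝ) * (5 : ℕ) = 1 by norm_num, Real.rpow_one, mul_div_assoc',
    div_le_iff₀ (by positivity)] at h5
  rw [mul_div_assoc', div_le_iff₀ (by positivity)]
  linarith

theorem sq_mul_errDiagonal_bias_le {γ η δ n : ℝ} (hγ : 0 < γ) (hη : 0 < η) (hn : 0 < n)
    (hδ : 0 < 1 - δ) (h : γ * n ^ (-(1 / 4) : ℝ) * (1 - δ) ^ (-(1 / 6) : ℝ) ≤ η) :
    γ ^ 2 * (γ ^ 4 / (n ^ (3 / 2 : ℝ) * η ^ 5)) ≤ (1 - δ) * η := by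
  have h6 := pow_le_pow_left₀ (by positivity) h 6
  rw [mul_pow, mul_pow, ← Real.rpow_natCast (n ^ _), ← Real.rpow_natCast ((1 - δ) ^ _),
    ← Real.rpow_mul hn.le, ← Real.rpow_mul hδ.le,
    show (-(1 / 4) : ℝ) * (6 : ℕ) = -(3 / 2) by norm_num,
    show (-(1 / 6) : ℝ) * (6 : ℕ) = -1 by norm_num, Real.rpow_neg hn.le, Real.rpow_neg_one] at h6
  have hr : 0 < n ^ (3 / 2 : ℝ) := by positivity
  generalize n ^ (3 / 2 : ℝ) = r at *
  rw [← div_eq_mul_inv, ← div_eq_mul_inv, div_div, div_le_iff₀ (by positivity)] at h6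
  rw [mul_div_assoc', div_le_iff₀ (by positivity)]
  linarith

theorem fixMap_eq_inv_selfEnergy (L D : Fin N → ℂ) (i : Fin N) :
    fixMap Γ Y L D i
      = (diagonal (fun a => L a - ∑ b, ((Γ a b / N : ℝ) : ℂ) * D b) - Y)⁻¹ i i := by
  have e : L - covMap Γ D = fun a => L a - ∑ b, ((Γ a b / N : ℝ) : ℂ) * D b := by
    funext a
    simp [covMap]
  rw [fixMap_apply, e]

end Deviation

end VarianceProfile

theorem corollary1p2
    (N : ℕ) (hN : 1 ≤ N)
    (Γ : Matrix (Fin N) (Fin N) ℝ) (hΓsymm : Γ.IsSymm) (hΓnonneg : ∀ i j, 0 ≤ Γ i j)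
    (Y : Matrix (Fin N) (Fin N) ℂ) (hY : Y.IsHermitian) :
    ∃ G : (Fin N → ℂ) → (Fin N → ℂ),
      VarianceProfile.IsDetEquiv Γ Y G ∧
      (∀ G' : (Fin N → ℂ) → (Fin N → ℂ), VarianceProfile.IsDetEquiv Γ Y G' →
        Set.EqOn G' G (VarianceProfile.upperDiag N)) ∧
      (∀ z : ℂ, 0 < z.im → ∀ D ∈ VarianceProfile.lowerDiag N,
        D = VarianceProfile.fixMap Γ Y (fun _ => z) D → D = G fun _ => z) ∧
      ∀ {Ω : Type*} [MeasurableSpace Ω] (P : Measure Ω) [IsProbabilityMeasure P]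
        (x : Ω → Matrix (Fin N) (Fin N) ℂ), VarianceProfile.IsUnnormalizedGUE x P →
        0 < VarianceProfile.gammaMax Γ →
        ∀ δ : ℝ, 0 < δ → δ < 1 →
        ∀ d : ℝ, 0 < d → (N = 1 ∨ 2 ≤ (N : ℝ) ^ d) →
        ∀ z : ℂ, 0 < z.im →
          (VarianceProfile.gammaMax Γ * (2 / ((N : ℝ) * (1 - δ))) ^ (1 / 5 : ℝ) ≤ z.im →
            P.real {ω | VarianceProfile.errGeneral N (VarianceProfile.gammaMax Γ) δ z.im d ≤
                ‖VarianceProfile.stieltjes (VarianceProfile.withProfile Γ (x ω) + Y) z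
                  - VarianceProfile.scalarTrace G z‖} ≤ (N : ℝ) ^ (-d)) ∧
          (Y.IsDiag →
            VarianceProfile.gammaMax Γ * (N : ℝ) ^ (-(1 / 4) : ℝ) * (1 - δ) ^ (-(1 / 6) : ℝ)
                ≤ z.im →
            P.real {ω | VarianceProfile.errDiagonal N (VarianceProfile.gammaMax Γ) δ z.im d ≤
                ‖VarianceProfile.stieltjes (VarianceProfile.withProfile Γ (x ω) + Y) z
                  - VarianceProfile.scalarTrace G z‖} ≤ (N : ℝ) ^ (-d)) := by
  open VarianceProfile in
  obtain ⟨G, hG⟩ := exists_isDetEquiv (N := N) hΓnonneg hY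
  refine ⟨G, hG, fun G' hG' L hL => ?_, fun z hz D hD hfix => ?_, ?_⟩
  · exact fixedPoint_unique hΓnonneg hY hL (hG'.mapsTo hL) (hG.mapsTo hL) (hG'.fixedPoint L hL)
      (hG.fixedPoint L hL)
  · have hup : (fun _ => z) ∈ upperDiag N := fun _ => hz
    exact fixedPoint_unique hΓnonneg hY hup hD (hG.mapsTo hup) hfix (hG.fixedPoint _ hup)
  intro Ω _ P _ x hx hγ δ hδ hδ1 d hd hNd z hz
  have hN0 : (0 : ℝ) < N := by exact_mod_cast hN
  have hδ' : 0 < 1 - δ := sub_pos.mpr hδ1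
  have hlog : 0 ≤ Real.log N := Real.log_nonneg (by exact_mod_cast hN)
  have hA := hasCovariance_withProfile hΓsymm hΓnonneg
  have hσ0 : ∀ i j, 0 ≤ Γ i j / (N : ℝ) := fun i j => div_nonneg (hΓnonneg i j) hN0.le
  have hσ : ∀ i j, Γ i j / (N : ℝ) ≤ gammaMax Γ ^ 2 / N := fun i j =>
    div_le_div_of_nonneg_right (le_gammaMax_sq hΓnonneg i j) hN0.le
  have hsq : (√2 * gammaMax Γ * √(2 * d * Real.log N) / (z.im ^ 2 * N)) ^ 2
      = 4 * (gammaMax Γ ^ 2 / (N ^ 2 * z.im ^ 4)) * (d * Real.log N) := by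
    rw [div_pow, mul_pow, mul_pow, Real.sq_sqrt zero_le_two, Real.sq_sqrt (by positivity)]
    field_simp
    ring
  constructor
  · intro hcond
    refine measureReal_deviation_le hN hΓsymm hΓnonneg hY hG P hx hγ hδ hNd hz
      (θ := 2 * gammaMax Γ ^ 3 / (N * z.im ^ 4)) (by positivity)
      (sq_mul_errGeneral_bias_le hγ hz hN0 hδ' hcond) (fun i => ?_) (by positivity) hsq
      (by rw [errGeneral, abs_of_pos hz])
    rw [fixMap_eq_inv_selfEnergy]
    refine (norm_meanResolvent_sub_le hA hY hz (fun _ => le_rfl) hσ0 hσ i).trans ?_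
    rw [Fintype.card_fin, show (N : ℝ) * (gammaMax Γ ^ 2 / N) ^ 3 = (gammaMax Γ ^ 3 / N) ^ 2 by
      field_simp, Real.sqrt_sq (by positivity), div_div]
    gcongr
    nlinarith [pow_pos hγ 3]
  · intro hYd hcond
    refine measureReal_deviation_le hN hΓsymm hΓnonneg hY hG P hx hγ hδ hNd hz
      (θ := gammaMax Γ ^ 4 / ((N : ℝ) ^ (3 / 2 : ℝ) * z.im ^ 5)) (by positivity)
      (sq_mul_errDiagonal_bias_le hγ hz hN0 hδ' hcond) (fun i => ?_) (by positivity) hsq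
      (by rw [errDiagonal, abs_of_pos hz, ← div_eq_mul_inv, div_div])
    rw [fixMap_eq_inv_selfEnergy]
    refine (norm_meanResolvent_sub_le_of_isDiag hA hY hYd hz (fun _ => le_rfl) hσ0 hσ i).trans_eq ?_
    have hr : (N : ℝ) ^ (3 / 2 : ℝ) * √(N : ℝ) = N ^ 2 := by
      rw [Real.sqrt_eq_rpow, ← Real.rpow_add hN0, ← Real.rpow_natCast]
      norm_num
    rw [Fintype.card_fin, div_eq_div_iff (by positivity) (by positivity), div_pow]
    have hN2 : (N : ℝ) ^ 2 ≠ 0 := by positivity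
    field_simp
    rw [← hr]
    ring
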